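/- \textbf{Model.} Let $n,d\ge 1$, let $a_1^0,a_2^0,\dots\in\mathbb{R}^n$ be nonrandom vectors, let $X_0\in\mathbb{R}^{n\times d}$, and for $m\ge 1$ let $A_0=A_0(m)$ be the $m\times n$ matrix with rows $(a_1^0)^\top,\dots,(a_m^0)^\top$. Let $\tilde c_i=(\delta_{ij})_{j=1}^{n+d}$, $i\ge 1$, be random vectors and let $\widetilde C=(\delta_{ij})_{i\le m,\,j\le n+d}$. One observes $C=[A_0\ \ A_0X_0]+\widetilde C\in\mathbb{R}^{m\times(n+d)}$. Assume that (i) the vectors $\tilde c_1,\tilde c_2,\dots$ are mutually independent; (ii) $\mathsf{E}\,\delta_{ij}=0$ and $\mathsf{E}\,\delta_{ij}\delta_{ik}=\Sigma_{jk}$ for all $i,j,k$, with one $(n+d)\times(n+d)$ matrix $\Sigma$ (possibly singular) not depending on $i$; (iii) $\operatorname{rank}\bigl(\Sigma\binom{X_0}{-I_d}\bigr)=d$. \textbf{Estimator.} Write $M^\dagger$ for the Moore--Penrose pseudoinverse, $P_\Sigma=\Sigma\Sigma^\dagger$, and $\|\cdot\|_F$ for the Frobenius norm. For each $m$, let $\Delta\in\mathbb{R}^{m\times(n+d)}$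 be a minimizer of $$\|\Delta(\Sigma^{1/2})^\dagger\|_F\quad\text{subject to}\quad \Delta(I-P_\Sigma)=0,\quad \operatorname{rank}(C-\Delta)\le n,$$ and let $\widehat X_{\rm ext}$ be an $(n+d)\times d$ matrix of rank $d$ with $(C-\Delta)\widehat X_{\rm ext}=0$. If the lower $d\times d$ block of $\widehat X_{\rm ext}$ is nonsingular, the estimation succeeds and the total least squares (TLS) estimator $\widehat X$ is the $n\times d$ matrix for which $\binom{\widehat X}{-I_d}$ is obtained from $\widehat X_{\rm ext}$ by right multiplication by a nonsingular matrix; otherwise the estimation fails and $\widehat X$ is arbitrary. \textbf{Theorem.} Suppose that for some real $r$ with $1\le r\le 2$, $$\sup_{i\ge 1,\ 1\le j\le n+d}\mathsf{E}|\delta_{ij}|^{2r}<\infty\qquad\text{and}\qquad m^{-1/r}\,\lambda_{\min}(A_0^\top A_0)\to\infty\quad (m\to\infty).$$ Then suitable $\Delta$ and $\widehat X_{\rm ext}$ always exist and, no matter how $\Delta$, $\widehat X_{\rm ext}$ (and $\widehat X$ upon failure) are chosen, the probability that the estimation fails tends to $0$ and $\widehat X\to X_0$ in probability as $m\to\infty$.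 (If the choices are not measurable, probabilities are understood as outer probabilities.) -/

import Mathlib

open Filter Topology MeasureTheory ProbabilityTheory Matrix
open scoped ENNReal MatrixOrder Matrix.Norms.Frobenius

namespace TLS

/-! ### Linear algebra: Moore-Penrose inverse, column-space projector, smallest eigenvalue -/

/-- The four Penrose equations: `G` is the Moore-Penrose pseudoinverse of the real matrix `A`. -/
structure IsMoorePenrose {ι κ : Type*} [Fintype ι] [Fintype κ]
    (A : Matrix ι κ ℝ) (G : Matrix κ ι ℝ) : Prop where
  mul_mul_self : A * G * A = A
  mul_mul_inv : G * A * G = G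
  symm_left : (A * G)ᵀ = A * G
  symm_right : (G * A)ᵀ = G * A

theorem IsMoorePenrose.unique {ι κ : Type*} [Fintype ι] [Fintype κ]
    {A : Matrix ι κ ℝ} {G H : Matrix κ ι ℝ} (hG : IsMoorePenrose A G) (hH : IsMoorePenrose A H) :
    G = H := by
  have h1 : A * G = A * H := by
    calc A * G = (A * G)ᵀ := hG.symm_left.symm
      _ = ((A * H) * (A * G))ᵀ := by rw [← Matrix.mul_assoc, hH.mul_mul_self]
      _ = (A * G) * (A * H) := by rw [transpose_mul, hG.symm_left, hH.symm_left]
      _ = A * H := by rw [← Matrix.mul_assoc, hG.mul_mul_self]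
  have h2 : G * A = H * A := by
    calc G * A = (G * A)ᵀ := hG.symm_right.symm
      _ = ((G * A) * (H * A))ᵀ := by
          rw [Matrix.mul_assoc G A (H * A), ← Matrix.mul_assoc A H A, hH.mul_mul_self]
      _ = (H * A) * (G * A) := by rw [transpose_mul, hG.symm_right, hH.symm_right]
      _ = H * A := by
          rw [Matrix.mul_assoc H A (G * A), ← Matrix.mul_assoc A G A, hG.mul_mul_self]
  calc G = G * A * G := hG.mul_mul_inv.symm
    _ = H * (A * G) := by rw [h2, Matrix.mul_assoc]
    _ = H * A * H := by rw [h1, Matrix.mul_assoc]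
    _ = H := hH.mul_mul_inv

theorem exists_isMoorePenrose {ι κ : Type*} [Fintype ι] [Fintype κ]
    (A : Matrix ι κ ℝ) : ∃ G : Matrix κ ι ℝ, IsMoorePenrose A G := by
  classical
  have hS : (Aᵀ * A).IsHermitian := by
    simpa using Matrix.isHermitian_conjTranspose_mul_self A
  obtain ⟨U, D, hU, hU', hD⟩ : ∃ (U : Matrix κ κ ℝ) (D : κ → ℝ),
      Uᵀ * U = 1 ∧ U * Uᵀ = 1 ∧ Aᵀ * A = U * diagonal D * Uᵀ := by
    refine ⟨hS.eigenvectorUnitary, hS.eigenvalues, ?_, ?_, ?_⟩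
    · have := Unitary.coe_star_mul_self hS.eigenvectorUnitary
      simpa [star_eq_conjTranspose] using this
    · have := Unitary.coe_mul_star_self hS.eigenvectorUnitary
      simpa [star_eq_conjTranspose] using this
    · have := hS.spectral_theorem
      rw [Unitary.conjStarAlgAut_apply] at this
      simpa [star_eq_conjTranspose, Function.comp_def] using this
  set E : Matrix κ κ ℝ := diagonal (fun i => (D i)⁻¹)
  set D' : Matrix κ κ ℝ := diagonal D
  have hED : E * D' = D' * E := by
    simp [E, D', diagonal_mul_diagonal, mul_comm]
  have hDED : D' * E * D' = D' := by
    simp only [E, D', diagonal_mul_diagonal]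
    congr 1; funext i
    by_cases h : D i = 0 <;> simp [h]
  have hEDE : E * D' * E = E := by
    simp only [E, D', diagonal_mul_diagonal]
    congr 1; funext i
    by_cases h : D i = 0 <;> simp [h]
  have hEt : Eᵀ = E := by simp [E]
  have hDt : D'ᵀ = D' := by simp [D']
  have hW : (A * U)ᵀ * (A * U) = D' := by
    calc (A * U)ᵀ * (A * U) = Uᵀ * (Aᵀ * A) * U := by
          simp only [transpose_mul, Matrix.mul_assoc]
      _ = (Uᵀ * U) * D' * (Uᵀ * U) := by rw [hD]; simp only [Matrix.mul_assoc]
      _ = D' := by rw [hU]; simp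
  have hWE : A * U * (E * D') = A * U := by
    have h0 : (A * U * (E * D' - 1))ᵀ * (A * U * (E * D' - 1)) = 0 := by
      calc (A * U * (E * D' - 1))ᵀ * (A * U * (E * D' - 1))
          = (E * D' - 1)ᵀ * (((A * U)ᵀ * (A * U)) * (E * D' - 1)) := by
            simp only [transpose_mul, Matrix.mul_assoc]
        _ = 0 := by
            rw [hW, Matrix.mul_sub, ← Matrix.mul_assoc, hDED]; simp
    have h1 : A * U * (E * D' - 1) = 0 := by
      have := (Matrix.conjTranspose_mul_self_eq_zero (A := A * U * (E * D' - 1))).1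
        (by simpa using h0)
      exact this
    rw [Matrix.mul_sub, Matrix.mul_one] at h1
    exact sub_eq_zero.1 h1
  have hGA : U * E * Uᵀ * Aᵀ * A = U * (E * D') * Uᵀ := by
    calc U * E * Uᵀ * Aᵀ * A = U * E * Uᵀ * (Aᵀ * A) := by simp only [Matrix.mul_assoc]
      _ = U * E * (Uᵀ * U) * D' * Uᵀ := by rw [hD]; simp only [Matrix.mul_assoc]
      _ = U * (E * D') * Uᵀ := by rw [hU]; simp only [Matrix.mul_assoc, Matrix.mul_one]
  refine ⟨U * E * Uᵀ * Aᵀ, ?_, ?_, ?_, ?_⟩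
  · calc A * (U * E * Uᵀ * Aᵀ) * A = A * (U * E * Uᵀ * Aᵀ * A) := by
          simp only [Matrix.mul_assoc]
      _ = A * U * (E * D') * Uᵀ := by rw [hGA]; simp only [Matrix.mul_assoc]
      _ = A := by rw [hWE, Matrix.mul_assoc, hU', Matrix.mul_one]
  · rw [hGA]
    calc U * (E * D') * Uᵀ * (U * E * Uᵀ * Aᵀ)
        = U * (E * D') * (Uᵀ * U) * E * Uᵀ * Aᵀ := by simp only [Matrix.mul_assoc]
      _ = U * (E * D' * E) * Uᵀ * Aᵀ := by
          rw [hU]; simp only [Matrix.mul_assoc, Matrix.one_mul]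
      _ = U * E * Uᵀ * Aᵀ := by rw [hEDE]
  · simp only [transpose_mul, transpose_transpose, hEt, Matrix.mul_assoc]
  · rw [hGA]
    simp only [transpose_mul, transpose_transpose, hEt, hDt, ← hED, Matrix.mul_assoc]

/-- The Moore-Penrose pseudoinverse of a real matrix. -/
noncomputable def pinv {ι κ : Type*} [Fintype ι] [Fintype κ] (A : Matrix ι κ ℝ) :
    Matrix κ ι ℝ :=
  (exists_isMoorePenrose A).choose

theorem pinv_spec {ι κ : Type*} [Fintype ι] [Fintype κ] (A : Matrix ι κ ℝ) :
    IsMoorePenrose A (pinv A) :=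
  (exists_isMoorePenrose A).choose_spec

/-- The orthogonal projector onto the column space of `A`. -/
noncomputable def colProj {ι κ : Type*} [Fintype ι] [Fintype κ] (A : Matrix ι κ ℝ) :
    Matrix ι ι ℝ :=
  A * pinv A

/-- The smallest eigenvalue of a (nonempty) symmetric real matrix: the least element of its
(finite, nonempty) real spectrum. -/
noncomputable def lambdaMin {ι : Type*} [Fintype ι] [DecidableEq ι] (M : Matrix ι ι ℝ) : ℝ :=
  sInf (spectrum ℝ M)

/-- For a nonempty symmetric matrix, `lambdaMin` is the least eigenvalue. -/
theorem lambdaMin_isLeast {ι : Type*} [Fintype ι] [DecidableEq ι] [Nonempty ι]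
    {M : Matrix ι ι ℝ} (hM : M.IsHermitian) : IsLeast (spectrum ℝ M) (lambdaMin M) := by
  have h := hM.spectrum_real_eq_range_eigenvalues
  have hfin : (spectrum ℝ M).Finite := h ▸ Set.finite_range _
  have hne : (spectrum ℝ M).Nonempty := h ▸ Set.range_nonempty _
  exact ⟨hne.csInf_mem hfin, fun x hx => csInf_le hfin.bddBelow hx⟩

/-! ### The errors-in-variables model -/

/-- The `m × n` matrix `A₀` whose rows are the first `m` true regressors. -/
def trueRegressors {n : ℕ} (a₀ : ℕ → Fin n → ℝ) (m : ℕ) : Matrix (Fin m) (Fin n) ℝ :=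
  Matrix.of fun i j => a₀ i j

/-- The augmented coefficient matrix `(X; -I)`. -/
def augment {n d : ℕ} (X : Matrix (Fin n) (Fin d) ℝ) : Matrix (Fin n ⊕ Fin d) (Fin d) ℝ :=
  Matrix.fromRows X (-1)

/-- The observation matrix `C = [A₀  A₀ X₀] + C̃` based on the first `m` observations, for the
true regressors `a₀ i`, the coefficient matrix `X₀` and the error values `e i j`. The columns
`Sum.inl _` are those of the regressors, the columns `Sum.inr _` those of the responses. -/
def observations {n d : ℕ} (a₀ : ℕ → Fin n → ℝ) (X₀ : Matrix (Fin n) (Fin d) ℝ)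
    (e : ℕ → Fin n ⊕ Fin d → ℝ) (m : ℕ) : Matrix (Fin m) (Fin n ⊕ Fin d) ℝ :=
  Matrix.fromCols (trueRegressors a₀ m) (trueRegressors a₀ m * X₀) +
    Matrix.of fun (i : Fin m) j => e i j

/-! ### The total least squares estimator -/

/-- The constraint set of the total least squares problem: `Δ (I - P_Σ) = 0` and
`rank (C - Δ) ≤ n`. -/
def feasible {n d m : ℕ} (S : Matrix (Fin n ⊕ Fin d) (Fin n ⊕ Fin d) ℝ)
    (C : Matrix (Fin m) (Fin n ⊕ Fin d) ℝ) : Set (Matrix (Fin m) (Fin n ⊕ Fin d) ℝ) :=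
  {Δ | Δ * (1 - colProj S) = 0 ∧ (C - Δ).rank ≤ n}

/-- The objective `‖Δ (Σ^{1/2})^†‖_F`; the norm is the Frobenius norm. -/
noncomputable def objective {n d m : ℕ} (S : Matrix (Fin n ⊕ Fin d) (Fin n ⊕ Fin d) ℝ)
    (Δ : Matrix (Fin m) (Fin n ⊕ Fin d) ℝ) : ℝ :=
  ‖Δ * pinv (CFC.sqrt S)‖

/-- `Δ` solves the constrained minimization problem and `Z` is an `(n+d) × d` matrix of full
rank with `(C - Δ) Z = 0`. -/
structure IsSolution {n d m : ℕ} (S : Matrix (Fin n ⊕ Fin d) (Fin n ⊕ Fin d) ℝ)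
    (C Δ : Matrix (Fin m) (Fin n ⊕ Fin d) ℝ) (Z : Matrix (Fin n ⊕ Fin d) (Fin d) ℝ) : Prop where
  mem_feasible : Δ ∈ feasible S C
  isMinOn : IsMinOn (objective S) (feasible S C) Δ
  rank_eq : Z.rank = d
  mul_eq_zero : (C - Δ) * Z = 0

/-- The estimation succeeds for `Z`: its lower `d × d` block is nonsingular. -/
def Succeeds {n d : ℕ} (Z : Matrix (Fin n ⊕ Fin d) (Fin d) ℝ) : Prop :=
  IsUnit Z.toRows₂

/-- `X` is the total least squares estimate obtained from `Z`: `(X; -I)` arises from `Z` by right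
multiplication by a nonsingular matrix. -/
def IsEstimate {n d : ℕ} (Z : Matrix (Fin n ⊕ Fin d) (Fin d) ℝ)
    (X : Matrix (Fin n) (Fin d) ℝ) : Prop :=
  ∃ Q : Matrix (Fin d) (Fin d) ℝ, IsUnit Q ∧ Z * Q = augment X

/-- When the estimation succeeds, there is exactly one estimate, `-Z₁ Z₂⁻¹`. -/
theorem isEstimate_iff {n d : ℕ} {Z : Matrix (Fin n ⊕ Fin d) (Fin d) ℝ} (hZ : Succeeds Z)
    (X : Matrix (Fin n) (Fin d) ℝ) : IsEstimate Z X ↔ X = -(Z.toRows₁ * Z.toRows₂⁻¹) := by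
  have hdet : IsUnit Z.toRows₂.det := (Matrix.isUnit_iff_isUnit_det _).1 hZ
  have key : ∀ Q : Matrix (Fin d) (Fin d) ℝ, Z * Q = fromRows (Z.toRows₁ * Q) (Z.toRows₂ * Q) :=
    fun Q => by rw [← fromRows_mul, fromRows_toRows]
  constructor
  · rintro ⟨Q, -, h⟩
    rw [key, augment] at h
    have h1 : Z.toRows₁ * Q = X := by simpa using congrArg toRows₁ h
    have h2 : Z.toRows₂ * Q = -1 := by simpa using congrArg toRows₂ h
    have hQ : Q = -Z.toRows₂⁻¹ := by
      calc Q = Z.toRows₂⁻¹ * (Z.toRows₂ * Q) := by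
            rw [← Matrix.mul_assoc, Matrix.nonsing_inv_mul _ hdet, Matrix.one_mul]
        _ = -Z.toRows₂⁻¹ := by rw [h2]; simp
    rw [← h1, hQ, Matrix.mul_neg]
  · rintro rfl
    refine ⟨-Z.toRows₂⁻¹, ?_, ?_⟩
    · exact ((Matrix.isUnit_nonsing_inv_iff).2 hZ).neg
    · rw [key, augment, Matrix.mul_neg, Matrix.mul_neg, Matrix.mul_nonsing_inv _ hdet]

end TLS

/-! Write `C = A₀ [I X₀] + E` and `R = Σ^{1/2}`. Consistency is a deterministic perturbation bound
combined with two probability estimates.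

For the deterministic part, normalise the kernel matrix `Z` of a solution, and the true kernel `Y =
augment X₀ * K`, so that `R Z` and `R Y` have orthonormal columns. The correction `E Y (R Y)ᵀ R` is
feasible with objective `‖E Y‖`, while `(C - Δ) Z = 0` bounds `‖M + E Z‖` by the optimal objective,
where `M = A₀ [I X₀] Z`. Hence `‖M + E Z‖² ≤ ‖E Y‖²`. Both `‖E Z‖²` and `‖E Y‖²` equal `m d` up to a
multiple of `‖Eᵀ E - m Σ‖`, so the dominant terms cancel. In the cross term only the projection of
`E` onto the columns of `A₀` matters. What remains (`IsSolution.norm_mul_sq_le`) bounds `λ_min ‖[I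
X₀] Z‖²` by a constant times `‖P_{A₀} E‖² + ‖Eᵀ E - m Σ‖`. A small `[I X₀] Z` means that the kernel
is close to the true one, whence success and accuracy (`isUnit_toRows₂_and_norm_le`).

For the probability part, both error terms must be `o(λ_min)` in probability. The expectation of
`‖P_{A₀} E‖²` is at most `n tr Σ`, so Markov's inequality suffices. The entries of `Eᵀ E - m Σ` are
sums of independent centered variables with only `r` bounded moments. A weak-type von Bahr-Esseen
inequality, proved with the Huber function (`huber_add_le`, `integral_huber_sum_le`), bounds their
tails at `η λ_min` by a multiple of `m λ_min ^ (-r)`, which tends to zero by the growth condition.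
-/

namespace TLS

/-! ### Frobenius norms, orthonormalisation and the smallest eigenvalue. -/

section LinearAlgebra

variable {ι κ l : Type*} [Fintype ι] [Fintype κ] [Fintype l]

theorem norm_sq_eq_sum (A : Matrix ι κ ℝ) : ‖A‖ ^ 2 = ∑ i, ∑ j, A i j ^ 2 := by
  rw [frobenius_norm_def, ← Real.sqrt_eq_rpow, Real.sq_sqrt (by positivity)]
  simp

theorem norm_sq_eq_trace (A : Matrix ι κ ℝ) : ‖A‖ ^ 2 = (Aᵀ * A).trace := by
  rw [norm_sq_eq_sum, Finset.sum_comm]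
  simp [trace, mul_apply, sq]

theorem norm_sq_eq_trace' (A : Matrix ι κ ℝ) : ‖A‖ ^ 2 = (A * Aᵀ).trace := by
  rw [norm_sq_eq_trace, trace_mul_comm]

theorem abs_trace_transpose_mul_le (A B : Matrix ι κ ℝ) : |(Aᵀ * B).trace| ≤ ‖A‖ * ‖B‖ := by
  have h : (Aᵀ * B).trace = ∑ p : ι × κ, A p.1 p.2 * B p.1 p.2 := by
    rw [Fintype.sum_prod_type, Finset.sum_comm]
    simp [trace, mul_apply]
  rw [h]
  refine abs_le_of_sq_le_sq ?_ (by positivity)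
  rw [mul_pow, norm_sq_eq_sum, norm_sq_eq_sum, ← Fintype.sum_prod_type', ← Fintype.sum_prod_type']
  exact Finset.sum_mul_sq_le_sq_mul_sq _ _ _

theorem norm_add_sq_eq (A B : Matrix ι κ ℝ) :
    ‖A + B‖ ^ 2 = ‖A‖ ^ 2 + 2 * (Aᵀ * B).trace + ‖B‖ ^ 2 := by
  have h : (Bᵀ * A).trace = (Aᵀ * B).trace := by
    rw [← trace_transpose, transpose_mul, transpose_transpose]
  simp only [norm_sq_eq_trace, transpose_add, Matrix.add_mul, Matrix.mul_add, trace_add, h]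
  ring

/-- Multiplication by a matrix with orthonormal columns does not increase the Frobenius norm. -/
theorem norm_mul_le_of_transpose_mul_self [DecidableEq κ] [DecidableEq l] (A : Matrix ι κ ℝ)
    {T : Matrix κ l ℝ} (hT : Tᵀ * T = 1) : ‖A * T‖ ^ 2 ≤ ‖A‖ ^ 2 := by
  have h : ‖A‖ ^ 2 - ‖A * T‖ ^ 2 = ‖A * (1 - T * Tᵀ)‖ ^ 2 := by
    have hidem : (1 - T * Tᵀ) * (1 - T * Tᵀ)ᵀ = 1 - T * Tᵀ := by
      have : T * Tᵀ * (T * Tᵀ) = T * Tᵀ := by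
        rw [Matrix.mul_assoc, ← Matrix.mul_assoc Tᵀ, hT, Matrix.one_mul]
      simp [Matrix.mul_sub, Matrix.sub_mul, this]
    rw [norm_sq_eq_trace' (A * (1 - T * Tᵀ)), transpose_mul, Matrix.mul_assoc,
      ← Matrix.mul_assoc (1 - T * Tᵀ), hidem, norm_sq_eq_trace', norm_sq_eq_trace']
    simp [Matrix.mul_sub, Matrix.sub_mul, Matrix.mul_assoc]
  nlinarith [sq_nonneg ‖A * (1 - T * Tᵀ)‖]

theorem mulVec_eq_zero_of_rank_eq_card {ι κ : Type*} [Fintype κ] {A : Matrix ι κ ℝ} (hA : A.rank = Fintype.card κ)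
    {v : κ → ℝ} (hv : A *ᵥ v = 0) : v = 0 := by
  have h := A.mulVecLin.finrank_range_add_finrank_ker
  rw [Module.finrank_fintype_fun_eq_card] at h
  have h0 : Module.finrank ℝ (LinearMap.ker A.mulVecLin) = 0 := by
    unfold rank at hA; omega
  have h1 := Submodule.finrank_eq_zero.1 h0
  have : v ∈ LinearMap.ker A.mulVecLin := by simpa using hv
  rw [h1] at this
  simpa using this

theorem posDef_transpose_mul_self {A : Matrix ι κ ℝ} (hA : ∀ v, A *ᵥ v = 0 → v = 0) :
    (Aᵀ * A).PosDef := by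
  have := PosDef.conjTranspose_mul_self A (fun v w hvw =>
    sub_eq_zero.1 (hA _ (by rw [mulVec_sub]; exact sub_eq_zero.2 hvw)))
  simpa using this

/-- A matrix with independent columns can be orthonormalised by right multiplication. -/
theorem exists_isUnit_orthonormalise [DecidableEq κ] {A : Matrix ι κ ℝ}
    (hA : ∀ v, A *ᵥ v = 0 → v = 0) :
    ∃ K : Matrix κ κ ℝ, IsUnit K ∧ (A * K)ᵀ * (A * K) = 1 := by
  have hpd := posDef_transpose_mul_self hA
  set M := Aᵀ * A
  have h0 : 0 ≤ M := hpd.posSemidef.nonneg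
  have hsq : CFC.sqrt M * CFC.sqrt M = M := CFC.sqrt_mul_sqrt_self M h0
  have hsymm : (CFC.sqrt M)ᵀ = CFC.sqrt M := by
    have := (nonneg_iff_posSemidef.1 (CFC.sqrt_nonneg M)).isHermitian
    simpa [IsHermitian] using this
  have hu : IsUnit (CFC.sqrt M) := by
    have hM := hpd.isUnit
    rw [← hsq] at hM
    exact isUnit_of_mul_isUnit_left hM
  have hdet : IsUnit (CFC.sqrt M).det := (isUnit_iff_isUnit_det _).1 hu
  refine ⟨(CFC.sqrt M)⁻¹, (isUnit_nonsing_inv_iff).2 hu, ?_⟩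
  calc (A * (CFC.sqrt M)⁻¹)ᵀ * (A * (CFC.sqrt M)⁻¹)
      = (CFC.sqrt M)⁻¹ * M * (CFC.sqrt M)⁻¹ := by
        rw [transpose_mul, transpose_nonsing_inv, hsymm]
        simp only [M, Matrix.mul_assoc]
    _ = ((CFC.sqrt M)⁻¹ * CFC.sqrt M) * (CFC.sqrt M * (CFC.sqrt M)⁻¹) := by
        rw [Matrix.mul_assoc _ (CFC.sqrt M), ← Matrix.mul_assoc (CFC.sqrt M), hsq,
          Matrix.mul_assoc]
    _ = 1 := by rw [nonsing_inv_mul _ hdet, mul_nonsing_inv _ hdet, Matrix.one_mul]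

/-- In the Loewner order `λ_min I ≤ Aᵀ A`; conjugate by `B` and take traces. This turns a bound on
`A₀ [I X₀] Z` into one on `[I X₀] Z`. -/
theorem lambdaMin_mul_norm_sq_le [DecidableEq κ] [Nonempty κ] (A : Matrix ι κ ℝ)
    (B : Matrix κ l ℝ) : lambdaMin (Aᵀ * A) * ‖B‖ ^ 2 ≤ ‖A * B‖ ^ 2 := by
  have hH : (Aᵀ * A).IsHermitian := by simpa using isHermitian_conjTranspose_mul_self A
  have hle : algebraMap ℝ (Matrix κ κ ℝ) (lambdaMin (Aᵀ * A)) ≤ Aᵀ * A := by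
    rw [algebraMap_le_iff_le_spectrum (ha := hH)]
    exact fun x hx => (lambdaMin_isLeast hH).2 hx
  have hpsd := (le_iff.1 hle).conjTranspose_mul_mul_same B
  have htr := hpsd.trace_nonneg
  rw [conjTranspose_eq_transpose_of_trivial, Matrix.mul_sub, Matrix.sub_mul, trace_sub,
    Algebra.algebraMap_eq_smul_one] at htr
  rw [norm_sq_eq_trace, norm_sq_eq_trace, transpose_mul]
  simp only [Matrix.mul_smul, Matrix.smul_mul, Matrix.mul_one, trace_smul, smul_eq_mul,
    Matrix.mul_assoc] at htr ⊢
  linarith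

end LinearAlgebra

/-! ### Projectors built from the pseudoinverse. -/

section PseudoInverse

variable {ι κ : Type*} [Fintype ι] [Fintype κ]

theorem colProj_transpose (A : Matrix ι κ ℝ) : (colProj A)ᵀ = colProj A :=
  (pinv_spec A).symm_left

theorem colProj_mul_self (A : Matrix ι κ ℝ) : colProj A * A = A :=
  (pinv_spec A).mul_mul_self

theorem colProj_mul_colProj (A : Matrix ι κ ℝ) : colProj A * colProj A = colProj A := by
  conv_lhs => enter [2]; rw [colProj]
  rw [← Matrix.mul_assoc, colProj_mul_self, colProj]

/-- By cyclicity the trace is that of `Q = A† A`, a symmetric idempotent of size `κ`. Its diagonal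
entries satisfy `Q i i = ∑ j, Q i j ^ 2 ≥ Q i i ^ 2`, so they are at most one. The bound therefore
does not grow with the number of rows. -/
theorem trace_colProj_le (A : Matrix ι κ ℝ) : (colProj A).trace ≤ Fintype.card κ := by
  set Q := pinv A * A with hQ
  have hQt : Qᵀ = Q := (pinv_spec A).symm_right
  have hQQ : Q * Q = Q := by
    rw [hQ, ← Matrix.mul_assoc, (pinv_spec A).mul_mul_inv]
  have hdiag : ∀ i, Q i i ≤ 1 := by
    intro i
    have h1 : Q i i = ∑ j, Q i j ^ 2 := by
      conv_lhs => rw [← hQQ, mul_apply]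
      refine Finset.sum_congr rfl fun j _ => ?_
      have : Q j i = Q i j := congrFun (congrFun hQt i) j
      rw [this, sq]
    have h2 : Q i i ^ 2 ≤ ∑ j, Q i j ^ 2 :=
      Finset.single_le_sum (f := fun j => Q i j ^ 2) (fun j _ => sq_nonneg _) (Finset.mem_univ i)
    nlinarith
  calc (colProj A).trace = Q.trace := by rw [colProj, trace_mul_comm]
    _ ≤ ∑ _i : κ, (1 : ℝ) := Finset.sum_le_sum fun i _ => hdiag i
    _ = Fintype.card κ := by simp

theorem pinv_transpose {A : Matrix ι ι ℝ} (hA : Aᵀ = A) : (pinv A)ᵀ = pinv A := by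
  refine IsMoorePenrose.unique (A := A) ⟨?_, ?_, ?_, ?_⟩ (pinv_spec A)
  · have := congrArg transpose (pinv_spec A).mul_mul_self
    simpa only [transpose_mul, hA, Matrix.mul_assoc] using this
  · have := congrArg transpose (pinv_spec A).mul_mul_inv
    simpa only [transpose_mul, hA, Matrix.mul_assoc] using this
  · have h := (pinv_spec A).symm_right
    rw [transpose_mul, hA] at h
    rw [transpose_mul, transpose_transpose, hA, h]
  · have h := (pinv_spec A).symm_left
    rw [transpose_mul, hA] at h
    rw [transpose_mul, transpose_transpose, hA, h]

theorem pinv_mul_comm {A : Matrix ι ι ℝ} (hA : Aᵀ = A) : pinv A * A = A * pinv A := by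
  have h := (pinv_spec A).symm_left
  rwa [transpose_mul, hA, pinv_transpose hA] at h

/-- A symmetric `R` and its square have the same column space: each of the two projectors fixes the
other, and transposing makes them equal. -/
theorem colProj_mul_self_of_symm {R : Matrix ι ι ℝ} (hR : Rᵀ = R) :
    colProj (R * R) = R * pinv R := by
  set P := colProj (R * R)
  have hPt : Pᵀ = P := colProj_transpose _
  have hPR : P * R = R := by
    have h0 : P * (R * R) = R * R := colProj_mul_self _
    have h1 : (P * R - R) * (P * R - R)ᵀ = 0 := by
      have : (P * R - R) * (P * R - R)ᵀ = (P * (R * R) - R * R) * P - (P * (R * R) - R * R) := by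
        simp only [transpose_sub, transpose_mul, hPt, hR, Matrix.sub_mul, Matrix.mul_sub,
          Matrix.mul_assoc]
      rw [this, h0]; simp
    exact sub_eq_zero.1 (self_mul_conjTranspose_eq_zero.1 (by simpa using h1))
  have hQP : R * pinv R * P = P := by
    simp only [P, colProj]
    rw [← Matrix.mul_assoc, ← Matrix.mul_assoc (R * pinv R), (pinv_spec R).mul_mul_self]
  calc P = (R * pinv R * P)ᵀ := by rw [hQP, hPt]
    _ = P * (R * pinv R) := by rw [transpose_mul, hPt, (pinv_spec R).symm_left]
    _ = R * pinv R := by rw [← Matrix.mul_assoc, hPR]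

end PseudoInverse

/-! ### The square root of the covariance matrix. -/

section Sqrt

variable {ι : Type*} [Fintype ι] [DecidableEq ι] {S : Matrix ι ι ℝ}

theorem sqrt_transpose (S : Matrix ι ι ℝ) : (CFC.sqrt S)ᵀ = CFC.sqrt S := by
  have := (nonneg_iff_posSemidef.1 (CFC.sqrt_nonneg S)).isHermitian
  simpa [IsHermitian] using this

theorem sqrt_mul_sqrt (hS : S.PosSemidef) : CFC.sqrt S * CFC.sqrt S = S :=
  CFC.sqrt_mul_sqrt_self S hS.nonneg

theorem colProj_eq_sqrt_mul_pinv (hS : S.PosSemidef) :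
    colProj S = CFC.sqrt S * pinv (CFC.sqrt S) := by
  conv_lhs => rw [← sqrt_mul_sqrt hS]
  exact colProj_mul_self_of_symm (sqrt_transpose S)

theorem colProj_eq_pinv_mul_sqrt (hS : S.PosSemidef) :
    colProj S = pinv (CFC.sqrt S) * CFC.sqrt S := by
  rw [colProj_eq_sqrt_mul_pinv hS, pinv_mul_comm (sqrt_transpose S)]

theorem sqrt_mul_mulVec_eq_zero (hS : S.PosSemidef) {v : ι → ℝ} (hv : CFC.sqrt S *ᵥ v = 0) :
    S *ᵥ v = 0 := by
  rw [← sqrt_mul_sqrt hS, ← mulVec_mulVec, hv, mulVec_zero]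

end Sqrt

/-! ### Existence of a solution. -/

section Existence

/-- Rank is lower semicontinuous: the complement is the set of rank at least `n + 1`, which is open
for continuous linear maps. -/
theorem isClosed_setOf_rank_le {ι κ : Type*} [Fintype ι] [Fintype κ] (n : ℕ) :
    IsClosed {A : Matrix ι κ ℝ | A.rank ≤ n} := by
  classical
  have hopen := isOpen_setOfPred_nat_le_rank (𝕜 := ℝ) (E := κ → ℝ) (F := ι → ℝ) (n + 1)
  let φ : Matrix ι κ ℝ →ₗ[ℝ] ((κ → ℝ) →L[ℝ] (ι → ℝ)) :=
    LinearMap.toContinuousLinearMap.toLinearMap ∘ₗ (Matrix.toLin' (R := ℝ)).toLinearMap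
  have hφ : Continuous φ := φ.continuous_of_finiteDimensional
  rw [← isOpen_compl_iff]
  convert hopen.preimage hφ using 1
  ext A
  have h1 : ((φ A : (κ → ℝ) →L[ℝ] (ι → ℝ)) : (κ → ℝ) →ₗ[ℝ] (ι → ℝ)) = A.mulVecLin := by
    ext; simp [φ]
  have h2 : A ∈ φ ⁻¹' {f | ((n + 1 : ℕ) : Cardinal) ≤ LinearMap.rank (f : (κ → ℝ) →ₗ[ℝ] (ι → ℝ))} ↔
      n + 1 ≤ A.rank := by
    change ((n + 1 : ℕ) : Cardinal) ≤ LinearMap.rank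
      ((φ A : (κ → ℝ) →L[ℝ] (ι → ℝ)) : (κ → ℝ) →ₗ[ℝ] (ι → ℝ)) ↔ _
    rw [h1, LinearMap.rank, ← Module.finrank_eq_rank, Nat.cast_le, rank]
  refine Iff.trans ?_ h2.symm
  change ¬ A.rank ≤ n ↔ _
  omega

theorem exists_rank_eq_mul_eq_zero {ι κ : Type*} [Fintype κ] (A : Matrix ι κ ℝ) (d : ℕ)
    (h : A.rank + d ≤ Fintype.card κ) :
    ∃ Z : Matrix κ (Fin d) ℝ, Z.rank = d ∧ A * Z = 0 := by
  have hd : d ≤ Module.finrank ℝ (LinearMap.ker A.mulVecLin) := by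
    have := A.mulVecLin.finrank_range_add_finrank_ker
    rw [Module.finrank_fintype_fun_eq_card] at this
    unfold rank at h; omega
  obtain ⟨f, hf⟩ := exists_linearIndependent_of_le_finrank hd
  have hf' : LinearIndependent ℝ (fun i => (f i : κ → ℝ)) :=
    hf.map' (LinearMap.ker A.mulVecLin).subtype (Submodule.ker_subtype _)
  let W : Matrix (Fin d) κ ℝ := Matrix.of fun i => (f i : κ → ℝ)
  refine ⟨Wᵀ, ?_, ?_⟩
  · rw [rank_transpose]
    simpa using LinearIndependent.rank_matrix (M := W) hf'
  · ext i j
    have hk : A *ᵥ (f j : κ → ℝ) = 0 := LinearMap.mem_ker.1 (f j).2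
    simpa [mul_apply, mulVec, dotProduct, W] using congrFun hk i

variable {n d m : ℕ} {S : Matrix (Fin n ⊕ Fin d) (Fin n ⊕ Fin d) ℝ}

theorem mul_colProj_of_mul_one_sub {Δ : Matrix (Fin m) (Fin n ⊕ Fin d) ℝ}
    (h : Δ * (1 - colProj S) = 0) : Δ * colProj S = Δ := by
  rw [Matrix.mul_sub, Matrix.mul_one, sub_eq_zero] at h
  exact h.symm

/-- The residual `C (1 - P_Σ)` has rank at most `n + d - rank Σ ≤ n`, because `1 - P_Σ` annihilates
`Σ`. -/
theorem mul_colProj_mem_feasible (hS : d ≤ S.rank) (C : Matrix (Fin m) (Fin n ⊕ Fin d) ℝ) :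
    C * colProj S ∈ feasible S C := by
  constructor
  · rw [Matrix.mul_assoc, Matrix.mul_sub, colProj_mul_colProj]; simp
  · have h0 : (1 - colProj S) * S = 0 := by
      rw [Matrix.sub_mul, colProj_mul_self]; simp
    have h1 := rank_add_rank_le_card_of_mul_eq_zero h0
    have h2 : C - C * colProj S = C * (1 - colProj S) := by simp [Matrix.mul_sub]
    have h3 := rank_mul_le_right C (1 - colProj S)
    simp only [Fintype.card_sum, Fintype.card_fin] at h1
    rw [h2]; omega

theorem isClosed_feasible (C : Matrix (Fin m) (Fin n ⊕ Fin d) ℝ) :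
    IsClosed (feasible S C) := by
  refine IsClosed.inter ?_ ?_
  · exact isClosed_eq (by fun_prop) continuous_const
  · exact (isClosed_setOf_rank_le n).preimage (continuous_const.sub continuous_id)

/-- For singular `Σ` the objective is only a seminorm. The constraint `Δ (1 - P_Σ) = 0` restores
coercivity, since then `Δ = (Δ R†) R`. -/
theorem norm_le_objective_mul (hS : S.PosSemidef) {Δ : Matrix (Fin m) (Fin n ⊕ Fin d) ℝ}
    (h : Δ * (1 - colProj S) = 0) : ‖Δ‖ ≤ objective S Δ * ‖CFC.sqrt S‖ := by
  have h1 : Δ = Δ * pinv (CFC.sqrt S) * CFC.sqrt S := by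
    rw [Matrix.mul_assoc, ← colProj_eq_pinv_mul_sqrt hS, mul_colProj_of_mul_one_sub h]
  calc ‖Δ‖ = ‖Δ * pinv (CFC.sqrt S) * CFC.sqrt S‖ := by rw [← h1]
    _ ≤ _ := frobenius_norm_mul _ _

/-- Minimise over the compact part of the feasible set lying in a ball that contains every point no
worse than `C P_Σ`; the rank constraint then leaves a kernel of dimension at least `d`. -/
theorem exists_isSolution (hS : S.PosSemidef) (hr : d ≤ S.rank)
    (C : Matrix (Fin m) (Fin n ⊕ Fin d) ℝ) : ∃ Δ Z, IsSolution S C Δ Z := by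
  have hcont : Continuous (objective (n := n) (d := d) (m := m) S) := by
    unfold objective; fun_prop
  have hmem := mul_colProj_mem_feasible hr C
  have hcpt : IsCompact (feasible S C ∩
      Metric.closedBall 0 (objective S (C * colProj S) * ‖CFC.sqrt S‖)) := by
    have : ProperSpace (Matrix (Fin m) (Fin n ⊕ Fin d) ℝ) := FiniteDimensional.proper ℝ _
    exact (isCompact_closedBall _ _).inter_left (isClosed_feasible C)
  obtain ⟨Δ, hΔ, hmin⟩ := hcpt.exists_isMinOn
    ⟨C * colProj S, hmem, by simpa using norm_le_objective_mul hS hmem.1⟩ hcont.continuousOn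
  have hmin' : IsMinOn (objective S) (feasible S C) Δ := by
    intro Δ' hΔ'
    by_cases hle : objective S Δ' ≤ objective S (C * colProj S)
    · refine hmin ⟨hΔ', ?_⟩
      have := norm_le_objective_mul hS hΔ'.1
      simp only [Metric.mem_closedBall, dist_zero_right]
      exact this.trans (by gcongr)
    · exact (hmin ⟨hmem, by simpa using norm_le_objective_mul hS hmem.1⟩).trans (not_le.1 hle).le
  obtain ⟨Z, hZ, hZ0⟩ := exists_rank_eq_mul_eq_zero (C - Δ) d (by
    have := hΔ.1.2
    simp only [Fintype.card_sum, Fintype.card_fin]; omega)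
  exact ⟨Δ, Z, hΔ.1, hmin', hZ, hZ0⟩

end Existence

/-! ### Deterministic perturbation bound for solutions. -/

section Deterministic

variable {n d m : ℕ} {S : Matrix (Fin n ⊕ Fin d) (Fin n ⊕ Fin d) ℝ}

/-- The matrix `[I  X]`, whose rows are orthogonal to the columns of `augment X`. -/
def rowAugment (X : Matrix (Fin n) (Fin d) ℝ) : Matrix (Fin n) (Fin n ⊕ Fin d) ℝ :=
  fromCols 1 X

theorem rowAugment_mul_augment (X : Matrix (Fin n) (Fin d) ℝ) : rowAugment X * augment X = 0 := by
  simp [rowAugment, augment, fromCols_mul_fromRows]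

theorem mul_rowAugment (A : Matrix (Fin m) (Fin n) ℝ) (X : Matrix (Fin n) (Fin d) ℝ) :
    A * rowAugment X = fromCols A (A * X) := by
  simp [rowAugment, mul_fromCols]

/-- Every `Z` is determined by `[I  X] Z` and its lower block. -/
theorem eq_sub_augment_mul (X : Matrix (Fin n) (Fin d) ℝ) {κ : Type*}
    (Z : Matrix (Fin n ⊕ Fin d) κ ℝ) :
    Z = (fromRows 1 0 : Matrix (Fin n ⊕ Fin d) (Fin n) ℝ) * (rowAugment X * Z) - augment X * Z.toRows₂ := by
  conv_lhs => rw [← fromRows_toRows Z]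
  conv_rhs => enter [1, 2, 2]; rw [← fromRows_toRows Z]
  rw [rowAugment, fromCols_mul_fromRows, augment, fromRows_mul, fromRows_mul]
  ext i j
  rcases i with i | i <;> simp

theorem sqrt_mul_augment_mulVec_eq_zero (hS : S.PosSemidef) {X : Matrix (Fin n) (Fin d) ℝ}
    (hrank : (S * augment X).rank = d) {v : Fin d → ℝ}
    (hv : (CFC.sqrt S * augment X) *ᵥ v = 0) : v = 0 := by
  refine mulVec_eq_zero_of_rank_eq_card (A := S * augment X) (by simpa using hrank) ?_
  rw [← mulVec_mulVec] at hv ⊢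
  exact sqrt_mul_mulVec_eq_zero hS hv

/-- The normalisation says `Zᵀ Σ Z = 1`, so the leading term `c * d` is the same for every
normalised `Z`. Used with `c = m`, it cancels between the solution and the true kernel. -/
theorem norm_mul_sq_eq_add_trace (hS : S.PosSemidef) (c : ℝ)
    (E : Matrix (Fin m) (Fin n ⊕ Fin d) ℝ) {Z : Matrix (Fin n ⊕ Fin d) (Fin d) ℝ}
    (hZ : (CFC.sqrt S * Z)ᵀ * (CFC.sqrt S * Z) = 1) :
    ‖E * Z‖ ^ 2 = c * d + (Zᵀ * ((Eᵀ * E - c • S) * Z)).trace := by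
  have h1 : Zᵀ * (S * Z) = 1 := by
    rw [← hZ, transpose_mul, sqrt_transpose]
    conv_lhs => rw [← sqrt_mul_sqrt hS]
    simp only [Matrix.mul_assoc]
  rw [norm_sq_eq_trace, transpose_mul, Matrix.sub_mul, Matrix.mul_sub, trace_sub,
    Matrix.smul_mul, Matrix.mul_smul, h1, trace_smul, trace_one]
  simp [Matrix.mul_assoc]

/-- The criterion at a solution is bounded by its value at the true parameter. -/
theorem IsSolution.objective_sq_le (hS : S.PosSemidef) {X : Matrix (Fin n) (Fin d) ℝ}
    {A : Matrix (Fin m) (Fin n) ℝ} {E Δ : Matrix (Fin m) (Fin n ⊕ Fin d) ℝ}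
    {Z : Matrix (Fin n ⊕ Fin d) (Fin d) ℝ} {K : Matrix (Fin d) (Fin d) ℝ}
    (h : IsSolution S (A * rowAugment X + E) Δ Z) (hrank : (S * augment X).rank = d)
    (hK : IsUnit K)
    (hortho : (CFC.sqrt S * (augment X * K))ᵀ * (CFC.sqrt S * (augment X * K)) = 1) :
    objective S Δ ^ 2 ≤ ‖E * (augment X * K)‖ ^ 2 := by
  set R := CFC.sqrt S
  set Y := augment X * K
  -- This correction satisfies `Δ₀ Y = E Y`, so it makes `Y` a kernel of the corrected data;
  -- whitened, it is `E Y (R Y)ᵀ`, whose norm is `‖E Y‖`.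
  set Δ₀ := E * Y * (R * Y)ᵀ * R
  have hRt : Rᵀ = R := sqrt_transpose S
  have hobj : objective S Δ₀ ^ 2 = ‖E * Y‖ ^ 2 := by
    have h1 : Δ₀ * pinv R = E * Y * (R * Y)ᵀ := by
      simp only [Δ₀, transpose_mul, hRt, Matrix.mul_assoc]
      rw [← pinv_mul_comm hRt, ← Matrix.mul_assoc R, (pinv_spec R).mul_mul_self]
    have h2 : (R * Y)ᵀ * (R * Y)ᵀᵀ = 1 := by rw [transpose_transpose, hortho]
    rw [objective, h1, norm_sq_eq_trace', transpose_mul (E * Y), Matrix.mul_assoc,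
      ← Matrix.mul_assoc (R * Y)ᵀ, h2, Matrix.one_mul, ← norm_sq_eq_trace']
  have hYrank : Y.rank = d := by
    rw [rank_mul_eq_left_of_isUnit_det _ _ ((isUnit_iff_isUnit_det _).1 hK)]
    refine le_antisymm (by simpa using rank_le_card_width (augment X)) ?_
    exact hrank.ge.trans (rank_mul_le_right _ _)
  have hmem : Δ₀ ∈ feasible S (A * rowAugment X + E) := by
    constructor
    · have h1 : R * colProj S = R := by
        rw [colProj_eq_pinv_mul_sqrt hS, ← Matrix.mul_assoc, (pinv_spec R).mul_mul_self]
      rw [Matrix.mul_sub, Matrix.mul_one, Matrix.mul_assoc _ R, h1, sub_self]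
    · have h0 : (A * rowAugment X + E - Δ₀) * Y = 0 := by
        have h1 : A * rowAugment X * Y = 0 := by
          simp only [Y]
          rw [Matrix.mul_assoc, ← Matrix.mul_assoc (rowAugment X), rowAugment_mul_augment]
          simp
        have h2 : Δ₀ * Y = E * Y := by
          simp only [Δ₀]
          rw [Matrix.mul_assoc, Matrix.mul_assoc (E * Y), hortho, Matrix.mul_one]
        rw [Matrix.sub_mul, Matrix.add_mul, h1, h2]; simp
      have h1 := rank_add_rank_le_card_of_mul_eq_zero h0
      simp only [Fintype.card_sum, Fintype.card_fin] at h1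
      omega
  have hle : objective S Δ ≤ objective S Δ₀ := h.isMinOn hmem
  rw [← hobj]
  exact pow_le_pow_left₀ (norm_nonneg _) hle 2

/-- The whitened kernel matrix of a solution has independent columns. -/
theorem IsSolution.sqrt_mul_mulVec_eq_zero (hS : S.PosSemidef) {X : Matrix (Fin n) (Fin d) ℝ}
    {A : Matrix (Fin m) (Fin n) ℝ} {E Δ : Matrix (Fin m) (Fin n ⊕ Fin d) ℝ}
    {Z : Matrix (Fin n ⊕ Fin d) (Fin d) ℝ}
    (h : IsSolution S (A * rowAugment X + E) Δ Z) (hrank : (S * augment X).rank = d)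
    (hE : E * colProj S = E) (hA : ∀ v, A *ᵥ v = 0 → v = 0) {v : Fin d → ℝ}
    (hv : (CFC.sqrt S * Z) *ᵥ v = 0) : v = 0 := by
  -- Such an `M` factors as `(M R†) R`, so it kills `Z v`. Applied to `E` and `Δ`, this gives `A [I
  -- X] Z v = 0`; injectivity of `A` puts `Z v` in the range of `augment X`, where the rank
  -- hypothesis leaves only zero.
  have hker : ∀ M : Matrix (Fin m) (Fin n ⊕ Fin d) ℝ, M * colProj S = M → (M * Z) *ᵥ v = 0 := by
    intro M hM
    rw [← hM, colProj_eq_pinv_mul_sqrt hS, Matrix.mul_assoc, Matrix.mul_assoc,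
      ← mulVec_mulVec, ← mulVec_mulVec, hv]
    simp
  have h1 : (A * (rowAugment X * Z)) *ᵥ v = 0 := by
    have h2 : A * (rowAugment X * Z) = Δ * Z - E * Z := by
      have := h.mul_eq_zero
      rw [Matrix.sub_mul, Matrix.add_mul, sub_eq_zero] at this
      rw [← this, Matrix.mul_assoc]; simp
    rw [h2, sub_mulVec, hker E hE, hker Δ (mul_colProj_of_mul_one_sub h.mem_feasible.1), sub_zero]
  have h3 : (rowAugment X * Z) *ᵥ v = 0 := hA _ (by rwa [mulVec_mulVec])
  have h4 : Z *ᵥ v = -(augment X *ᵥ (Z.toRows₂ *ᵥ v)) := by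
    conv_lhs => rw [eq_sub_augment_mul X Z]
    rw [sub_mulVec, ← mulVec_mulVec, h3, mulVec_zero, zero_sub, mulVec_mulVec]
  have h5 : Z.toRows₂ *ᵥ v = 0 := by
    refine sqrt_mul_augment_mulVec_eq_zero hS hrank ?_
    rw [← mulVec_mulVec] at hv ⊢
    rw [h4, mulVec_neg, neg_eq_zero] at hv
    exact hv
  refine mulVec_eq_zero_of_rank_eq_card (A := Z) (by simpa using h.rank_eq) ?_
  rw [h4, h5]; simp

theorem norm_sq_of_transpose_mul_self_eq_one {ι : Type*} [Fintype ι] {T : Matrix ι (Fin d) ℝ}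
    (hT : Tᵀ * T = 1) : ‖T‖ ^ 2 = d := by
  rw [norm_sq_eq_trace, hT, trace_one]; simp

/-- Bound on the component of the kernel of a solution orthogonal to the true kernel. -/
theorem IsSolution.norm_mul_sq_le (hS : S.PosSemidef) {X : Matrix (Fin n) (Fin d) ℝ}
    {A : Matrix (Fin m) (Fin n) ℝ} {E Δ : Matrix (Fin m) (Fin n ⊕ Fin d) ℝ}
    {Z : Matrix (Fin n ⊕ Fin d) (Fin d) ℝ} {K : Matrix (Fin d) (Fin d) ℝ}
    (h : IsSolution S (A * rowAugment X + E) Δ Z) (hrank : (S * augment X).rank = d)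
    (hK : IsUnit K)
    (hortho : (CFC.sqrt S * (augment X * K))ᵀ * (CFC.sqrt S * (augment X * K)) = 1)
    (hE : E * colProj S = E) (hZ : (CFC.sqrt S * Z)ᵀ * (CFC.sqrt S * Z) = 1) :
    ‖A * (rowAugment X * Z)‖ ^ 2 ≤
      4 * (d * ‖pinv (CFC.sqrt S)‖ ^ 2) * ‖colProj A * E‖ ^ 2 +
      2 * (‖augment X * K‖ ^ 2 + d * ‖pinv (CFC.sqrt S)‖ ^ 2) * ‖Eᵀ * E - (m : ℝ) • S‖ := by
  set R := CFC.sqrt S with hR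
  set Y := augment X * K
  set D := Eᵀ * E - (m : ℝ) • S
  set M := A * (rowAugment X * Z)
  set T := R * Z
  have hRt : Rᵀ = R := sqrt_transpose S
  have hpt : (pinv R)ᵀ = pinv R := pinv_transpose hRt
  have hTn : ‖T‖ ^ 2 = d := norm_sq_of_transpose_mul_self_eq_one hZ
  have hER : E = E * pinv R * R := by
    rw [Matrix.mul_assoc, hR, ← colProj_eq_pinv_mul_sqrt hS, hE]
  have hup := h.objective_sq_le hS hrank hK hortho
  have hlow : ‖M + E * Z‖ ^ 2 ≤ objective S Δ ^ 2 := by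
    have h1 : M + E * Z = Δ * pinv R * T := by
      have h2 := h.mul_eq_zero
      rw [Matrix.sub_mul, Matrix.add_mul, sub_eq_zero] at h2
      simp only [M, T]
      rw [← Matrix.mul_assoc A, h2, ← Matrix.mul_assoc, Matrix.mul_assoc Δ, hR,
        ← colProj_eq_pinv_mul_sqrt hS, mul_colProj_of_mul_one_sub h.mem_feasible.1]
    rw [h1]
    exact norm_mul_le_of_transpose_mul_self _ hZ
  rw [norm_add_sq_eq, norm_mul_sq_eq_add_trace hS m E hZ] at hlow
  rw [norm_mul_sq_eq_add_trace hS m E hortho] at hup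
  have hY : (Yᵀ * (D * Y)).trace ≤ ‖Y‖ ^ 2 * ‖D‖ := by
    calc (Yᵀ * (D * Y)).trace ≤ ‖Y‖ * ‖D * Y‖ :=
          (le_abs_self _).trans (abs_trace_transpose_mul_le _ _)
      _ ≤ ‖Y‖ * (‖D‖ * ‖Y‖) := by gcongr; exact frobenius_norm_mul _ _
      _ = _ := by ring
  -- No a priori bound on `‖Z‖` is available, only `‖R Z‖² = d`. Since `D` lives on the range of
  -- `Σ`, the form `Zᵀ D Z` depends on `Z` through `R Z` alone.
  have hDP : D = R * (pinv R * D * pinv R) * R := by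
    have hS' : R * pinv R * S * (pinv R * R) = S := by
      rw [hR, ← colProj_eq_sqrt_mul_pinv hS, ← colProj_eq_pinv_mul_sqrt hS, colProj_mul_self]
      have h1 : Sᵀ = S := by simpa [IsHermitian] using hS.isHermitian
      have := congrArg transpose (colProj_mul_self S)
      rwa [transpose_mul, h1, colProj_transpose] at this
    have hE' : R * pinv R * (Eᵀ * E) * (pinv R * R) = Eᵀ * E := by
      have h1 : Eᵀ = R * pinv R * Eᵀ := by
        conv_lhs => rw [hER]
        rw [transpose_mul, transpose_mul, hRt, hpt, Matrix.mul_assoc]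
      conv_rhs => rw [hER, ← hER, h1]
      conv_rhs => enter [2]; rw [hER]
      simp only [Matrix.mul_assoc]
    have h2 : R * (pinv R * D * pinv R) * R = R * pinv R * D * (pinv R * R) := by
      simp only [Matrix.mul_assoc]
    rw [h2, Matrix.mul_sub, Matrix.sub_mul, hE', Matrix.mul_smul, Matrix.smul_mul, hS']
  have hZD : -(d * ‖pinv R‖ ^ 2 * ‖D‖) ≤ (Zᵀ * (D * Z)).trace := by
    have h1 : Zᵀ * (D * Z) = Tᵀ * (pinv R * D * pinv R * T) := by
      conv_lhs => rw [hDP]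
      simp only [T, transpose_mul, hRt, Matrix.mul_assoc]
    have h2 : |(Zᵀ * (D * Z)).trace| ≤ d * ‖pinv R‖ ^ 2 * ‖D‖ := by
      rw [h1, ← hTn]
      calc _ ≤ ‖T‖ * ‖pinv R * D * pinv R * T‖ := abs_trace_transpose_mul_le _ _
        _ ≤ ‖T‖ * (‖pinv R‖ * ‖D‖ * ‖pinv R‖ * ‖T‖) := by
            gcongr
            refine (frobenius_norm_mul _ _).trans ?_
            gcongr
            refine (frobenius_norm_mul _ _).trans ?_
            gcongr
            exact frobenius_norm_mul _ _
        _ = _ := by ring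
    exact (abs_le.1 h2).1
  -- The columns of `M` lie in the column space of `A`, so `E` may be replaced by its projection.
  have hcross : -(‖M‖ * (‖colProj A * E‖ * ‖pinv R‖ * ‖T‖)) ≤ (Mᵀ * (E * Z)).trace := by
    have h0 : colProj A * M = M := by
      rw [← Matrix.mul_assoc, colProj_mul_self]
    have h1 : Mᵀ * (E * Z) = Mᵀ * (colProj A * E * pinv R * T) := by
      conv_lhs => rw [← h0, transpose_mul, colProj_transpose, hER]
      simp only [T, Matrix.mul_assoc]
    have h2 : |(Mᵀ * (E * Z)).trace| ≤ ‖M‖ * (‖colProj A * E‖ * ‖pinv R‖ * ‖T‖) := by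
      rw [h1]
      refine (abs_trace_transpose_mul_le _ _).trans ?_
      gcongr
      refine (frobenius_norm_mul _ _).trans ?_
      gcongr
      exact frobenius_norm_mul _ _
    exact (abs_le.1 h2).1
  have hsq : (‖colProj A * E‖ * ‖pinv R‖ * ‖T‖) ^ 2 =
      d * ‖pinv R‖ ^ 2 * ‖colProj A * E‖ ^ 2 := by
    rw [mul_pow, mul_pow, hTn]; ring
  -- With `q` the factor multiplying `‖M‖` in `hcross`, Young's inequality `2 ‖M‖ q ≤ ‖M‖² / 2 + 2
  -- q²` absorbs the cross term.
  nlinarith [sq_nonneg (‖M‖ - 2 * (‖colProj A * E‖ * ‖pinv R‖ * ‖T‖))]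

/-- If `[I  X₀] Z` is small for a normalised `Z`, the lower block of `Z` is nonsingular with
bounded inverse. -/
theorem isUnit_toRows₂_and_norm_le {X₀ : Matrix (Fin n) (Fin d) ℝ}
    {Z : Matrix (Fin n ⊕ Fin d) (Fin d) ℝ} {R : Matrix (Fin n ⊕ Fin d) (Fin n ⊕ Fin d) ℝ}
    (hZ : (R * Z)ᵀ * (R * Z) = 1)
    (hB : √d * ‖R‖ * ‖(fromRows 1 0 : Matrix (Fin n ⊕ Fin d) (Fin n) ℝ)‖ *
      ‖rowAugment X₀ * Z‖ ≤ 1 / 2) :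
    IsUnit Z.toRows₂ ∧
      ∀ X, IsEstimate Z X → ‖X - X₀‖ ≤ ‖rowAugment X₀ * Z‖ * (2 * (√d * ‖R * augment X₀‖)) := by
  set B := rowAugment X₀ * Z
  set J : Matrix (Fin n ⊕ Fin d) (Fin n) ℝ := fromRows 1 0
  set T := R * Z
  have hTn : ‖Tᵀ‖ = √d := by
    rw [frobenius_norm_transpose, ← norm_sq_of_transpose_mul_self_eq_one hZ,
      Real.sqrt_sq (norm_nonneg _)]
  set F := Tᵀ * R * J * B
  have hF : ‖F‖ ≤ 1 / 2 := by
    refine le_trans ?_ hB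
    rw [← hTn]
    refine (frobenius_norm_mul _ _).trans ?_
    gcongr
    refine (frobenius_norm_mul _ _).trans ?_
    gcongr
    exact frobenius_norm_mul _ _
  -- Substitute the decomposition of `Z` into the second factor of `Tᵀ (R Z) = 1`. As `‖F‖ < 1`, the
  -- left side is invertible, hence so is the square block `Z.toRows₂`.
  have hid : 1 - F = -(Tᵀ * (R * augment X₀)) * Z.toRows₂ := by
    have h1 : (1 : Matrix (Fin d) (Fin d) ℝ) = F - Tᵀ * (R * augment X₀) * Z.toRows₂ := by
      rw [← hZ]
      conv_lhs => enter [2]; rw [show T = R * Z from rfl, eq_sub_augment_mul X₀ Z]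
      simp only [F, B, J, Matrix.mul_sub, Matrix.mul_assoc]
    conv_lhs => rw [h1]
    simp
  have hunit : IsUnit Z.toRows₂ := by
    have h1 : IsUnit (1 - F) := isUnit_one_sub_of_norm_lt_one (by linarith)
    rw [hid] at h1
    exact isUnit_of_mul_isUnit_right h1
  have hdet : IsUnit Z.toRows₂.det := (isUnit_iff_isUnit_det _).1 hunit
  refine ⟨hunit, fun X hX => ?_⟩
  set Y := Z.toRows₂⁻¹
  have hY : ‖Y‖ ≤ 2 * (√d * ‖R * augment X₀‖) := by
    have h1 : Y = F * Y - Tᵀ * (R * augment X₀) := by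
      have h2 : (1 - F) * Y = -(Tᵀ * (R * augment X₀)) := by
        rw [hid, Matrix.mul_assoc, mul_nonsing_inv _ hdet, Matrix.mul_one]
      rw [Matrix.sub_mul, Matrix.one_mul] at h2
      rw [eq_add_of_sub_eq h2]
      conv_rhs => rw [← eq_add_of_sub_eq h2]
      abel
    have h2 : ‖Y‖ ≤ ‖F‖ * ‖Y‖ + √d * ‖R * augment X₀‖ := by
      conv_lhs => rw [h1]
      refine (norm_sub_le _ _).trans (add_le_add (frobenius_norm_mul _ _) ?_)
      rw [← hTn]
      exact frobenius_norm_mul _ _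
    nlinarith [norm_nonneg Y]
  have hX' : X - X₀ = -(B * Y) := by
    have h1 : B = Z.toRows₁ + X₀ * Z.toRows₂ := by
      simp only [B]
      conv_lhs => rw [← fromRows_toRows Z]
      rw [rowAugment, fromCols_mul_fromRows, Matrix.one_mul]
    rw [(isEstimate_iff hunit X).1 hX, h1, Matrix.add_mul, Matrix.mul_assoc,
      mul_nonsing_inv _ hdet, Matrix.mul_one]
    abel
  rw [hX', norm_neg]
  refine (frobenius_norm_mul _ _).trans ?_
  gcongr

/-- Only the column space of `Z` matters; this freedom allows `R Z` to be orthonormalised. -/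
theorem IsSolution.mul_isUnit {C Δ : Matrix (Fin m) (Fin n ⊕ Fin d) ℝ}
    {Z : Matrix (Fin n ⊕ Fin d) (Fin d) ℝ} (h : IsSolution S C Δ Z)
    {K : Matrix (Fin d) (Fin d) ℝ} (hK : IsUnit K) : IsSolution S C Δ (Z * K) := by
  refine ⟨h.mem_feasible, h.isMinOn, ?_, ?_⟩
  · rw [rank_mul_eq_left_of_isUnit_det _ _ ((isUnit_iff_isUnit_det _).1 hK), h.rank_eq]
  · rw [← Matrix.mul_assoc, h.mul_eq_zero, Matrix.zero_mul]

theorem succeeds_mul_isUnit {Z : Matrix (Fin n ⊕ Fin d) (Fin d) ℝ} {K : Matrix (Fin d) (Fin d) ℝ}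
    (h : Succeeds (Z * K)) : Succeeds Z := by
  have h1 : (Z * K).toRows₂ = Z.toRows₂ * K := rfl
  rw [Succeeds, h1] at h
  exact isUnit_of_mul_isUnit_left h

theorem IsEstimate.mul_isUnit {Z : Matrix (Fin n ⊕ Fin d) (Fin d) ℝ}
    {X : Matrix (Fin n) (Fin d) ℝ} (h : IsEstimate Z X) {K : Matrix (Fin d) (Fin d) ℝ}
    (hK : IsUnit K) : IsEstimate (Z * K) X := by
  obtain ⟨Q, hQ, hQX⟩ := h
  refine ⟨K⁻¹ * Q, ((isUnit_nonsing_inv_iff).2 hK).mul hQ, ?_⟩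
  rw [Matrix.mul_assoc, ← Matrix.mul_assoc K, mul_nonsing_inv _ ((isUnit_iff_isUnit_det _).1 hK),
    Matrix.one_mul, hQX]

/-- Deterministic consistency: small error terms force success and an accurate estimate. -/
theorem exists_forall_succeeds_and_norm_sub_le [Nonempty (Fin n)] (hS : S.PosSemidef)
    {X₀ : Matrix (Fin n) (Fin d) ℝ} (hrank : (S * augment X₀).rank = d) {ε : ℝ} (hε : 0 < ε) :
    ∃ η > 0, ∀ (m : ℕ) (A : Matrix (Fin m) (Fin n) ℝ) (E Δ : Matrix (Fin m) (Fin n ⊕ Fin d) ℝ)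
      (Z : Matrix (Fin n ⊕ Fin d) (Fin d) ℝ), 0 < lambdaMin (Aᵀ * A) → E * colProj S = E →
      ‖Eᵀ * E - (m : ℝ) • S‖ ≤ η * lambdaMin (Aᵀ * A) →
      ‖colProj A * E‖ ^ 2 ≤ η * lambdaMin (Aᵀ * A) →
      IsSolution S (A * rowAugment X₀ + E) Δ Z →
      Succeeds Z ∧ ∀ X, IsEstimate Z X → ‖X - X₀‖ < ε := by
  obtain ⟨K, hK, hortho⟩ := exists_isUnit_orthonormalise
    (fun v hv => sqrt_mul_augment_mulVec_eq_zero hS hrank (v := v) hv)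
  rw [Matrix.mul_assoc] at hortho
  set a := √d * ‖CFC.sqrt S‖ * ‖(fromRows 1 0 : Matrix (Fin n ⊕ Fin d) (Fin n) ℝ)‖
  set b := 2 * (√d * ‖CFC.sqrt S * augment X₀‖)
  set p := d * ‖pinv (CFC.sqrt S)‖ ^ 2
  set c := 4 * p + 2 * (‖augment X₀ * K‖ ^ 2 + p)
  have ha : 0 ≤ a := by positivity
  have hb : 0 ≤ b := by positivity
  have hc : 0 ≤ c := by positivity
  obtain ⟨β, hβ, hβa, hβb⟩ : ∃ β : ℝ, 0 < β ∧ a * β ≤ 1 / 2 ∧ β * b < ε := by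
    -- The first term ensures invertibility of the lower block, the second the accuracy `ε`; adding
    -- one keeps the denominators positive.
    refine ⟨min (1 / (2 * (a + 1))) (ε / (b + 1)), by positivity, ?_, ?_⟩
    · calc a * min (1 / (2 * (a + 1))) (ε / (b + 1)) ≤ a * (1 / (2 * (a + 1))) := by
            gcongr; exact min_le_left _ _
        _ ≤ 1 / 2 := by
            rw [mul_one_div, div_le_div_iff₀ (by positivity) (by positivity)]; linarith
    · calc min (1 / (2 * (a + 1))) (ε / (b + 1)) * b ≤ ε / (b + 1) * b := by
            gcongr; exact min_le_right _ _
        _ < ε := by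
            rw [div_mul_eq_mul_div, div_lt_iff₀ (by positivity)]; nlinarith
  refine ⟨β ^ 2 / (c + 1), by positivity, fun m A E Δ Z hlam hE hD hH hsol => ?_⟩
  set lam := lambdaMin (Aᵀ * A)
  have hA : ∀ v, A *ᵥ v = 0 → v = 0 := by
    intro v hv
    have h1 := lambdaMin_mul_norm_sq_le A (replicateCol Unit v)
    have h2 : A * replicateCol Unit v = 0 := by
      rw [← replicateCol_mulVec, hv]; rfl
    rw [h2, norm_zero] at h1
    have h3 : ‖replicateCol Unit v‖ ^ 2 ≤ 0 := by
      by_contra hcon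
      nlinarith [mul_pos hlam (not_le.1 hcon)]
    have h4 : replicateCol Unit v = 0 := by
      rw [← norm_eq_zero]; nlinarith [norm_nonneg (replicateCol Unit v)]
    ext i
    exact congrFun (congrFun h4 i) ()
  obtain ⟨L, hL, hLo⟩ := exists_isUnit_orthonormalise
    (fun v hv => hsol.sqrt_mul_mulVec_eq_zero hS hrank hE hA (v := v) hv)
  rw [Matrix.mul_assoc] at hLo
  have hsol' := hsol.mul_isUnit hL
  have hB : ‖rowAugment X₀ * (Z * L)‖ ≤ β := by
    have h1 := hsol'.norm_mul_sq_le hS hrank hK hortho hE hLo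
    have h2 := lambdaMin_mul_norm_sq_le A (rowAugment X₀ * (Z * L))
    have h3 : lam * ‖rowAugment X₀ * (Z * L)‖ ^ 2 ≤ c * (β ^ 2 / (c + 1) * lam) := by
      calc _ ≤ 4 * p * (β ^ 2 / (c + 1) * lam) +
            2 * (‖augment X₀ * K‖ ^ 2 + p) * (β ^ 2 / (c + 1) * lam) := by
            refine h2.trans (h1.trans ?_)
            gcongr
        _ = _ := by simp only [c]; ring
    have h4 : c * (β ^ 2 / (c + 1) * lam) ≤ lam * β ^ 2 := by
      have : c * (β ^ 2 / (c + 1) * lam) = lam * β ^ 2 * (c / (c + 1)) := by ring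
      rw [this]
      refine mul_le_of_le_one_right (by positivity) ?_
      rw [div_le_one (by positivity)]; linarith
    exact le_of_sq_le_sq (le_of_mul_le_mul_left (h3.trans h4) hlam) hβ.le
  obtain ⟨hu, hX⟩ := isUnit_toRows₂_and_norm_le hLo
    ((mul_le_mul_of_nonneg_left hB ha).trans hβa)
  refine ⟨succeeds_mul_isUnit hu, fun X hXe => ?_⟩
  calc ‖X - X₀‖ ≤ ‖rowAugment X₀ * (Z * L)‖ * b := hX X (hXe.mul_isUnit hL)
    _ ≤ β * b := by gcongr
    _ < ε := hβb

end Deterministic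

/-! ### The Huber function. -/

section Huber

/-- Truncation to the interval `[-t, t]`. -/
def clamp (t x : ℝ) : ℝ := max (-t) (min t x)

/-- The Huber function: quadratic on `[-t, t]` and linear outside. -/
def huber (t x : ℝ) : ℝ := 2 * x * clamp t x - clamp t x ^ 2

@[fun_prop]
theorem continuous_clamp (t : ℝ) : Continuous (clamp t) := by
  unfold clamp; fun_prop

theorem abs_clamp_le {t : ℝ} (ht : 0 ≤ t) (x : ℝ) : |clamp t x| ≤ t := by
  rw [abs_le, clamp]
  exact ⟨le_max_left _ _, max_le (by linarith) (min_le_left _ _)⟩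

theorem abs_clamp_add_sub_le (t a b : ℝ) : |clamp t (a + b) - clamp t a| ≤ |b| := by
  unfold clamp
  refine (abs_max_sub_max_le_max _ _ _ _).trans ?_
  refine max_le (by simp) ((abs_min_sub_min_le_max _ _ _ _).trans ?_)
  simp

/-- For `t ≥ 0` the concave function `c ↦ 2 x c - c ^ 2` is maximised over `[-t, t]` at `clamp t x`.
This variational form yields every estimate on `huber` below. -/
theorem le_huber {t c : ℝ} (x : ℝ) (hc : |c| ≤ t) : 2 * x * c - c ^ 2 ≤ huber t x := by
  have hc' := abs_le.1 hc
  unfold huber clamp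
  rcases le_total t x with h | h
  · rw [min_eq_left h, max_eq_right (by linarith)]
    nlinarith
  · rw [min_eq_right h]
    rcases le_total x (-t) with h' | h'
    · rw [max_eq_left h']; nlinarith
    · rw [max_eq_right h']; nlinarith [sq_nonneg (x - c)]

theorem huber_nonneg {t : ℝ} (ht : 0 ≤ t) (x : ℝ) : 0 ≤ huber t x := by
  simpa using le_huber (t := t) x (c := 0) (by simpa using ht)

theorem sq_le_huber {t x : ℝ} (ht : 0 ≤ t) (hx : t ≤ |x|) : t ^ 2 ≤ huber t x := by
  rcases abs_cases x with ⟨h, -⟩ | ⟨h, -⟩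
  · have := le_huber (t := t) x (c := t) (by rw [abs_of_nonneg ht]); nlinarith
  · have := le_huber (t := t) x (c := -t) (by rw [abs_neg, abs_of_nonneg ht]); nlinarith

/-- A first-order expansion: `2 * clamp t` is the derivative of `huber t`. The remainder is `2 b (c'
- c)` with `|c' - c| ≤ min |b| (2 t)`, and interpolating the two bounds with weights `r - 1` and `2
- r` gives the power `|b| ^ r`. -/
theorem huber_add_le {t r : ℝ} (ht : 0 ≤ t) (hr1 : 1 ≤ r) (hr2 : r ≤ 2) (a b : ℝ) :
    huber t (a + b) ≤ huber t a + 2 * (clamp t a * b) + 2 * (2 * t) ^ (2 - r) * |b| ^ r := by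
  set c := clamp t a
  set c' := clamp t (a + b)
  have h1 : 2 * a * c' - c' ^ 2 ≤ huber t a := le_huber a (abs_clamp_le ht _)
  have h2 : huber t (a + b) ≤ huber t a + 2 * (c * b) + 2 * (b * (c' - c)) := by
    have : huber t (a + b) = 2 * (a + b) * c' - c' ^ 2 := rfl
    linarith
  have h3 : |c' - c| ≤ |b| := abs_clamp_add_sub_le t a b
  have h4 : |c' - c| ≤ 2 * t := by
    refine (abs_sub _ _).trans ?_
    linarith [abs_clamp_le ht a, abs_clamp_le ht (a + b)]
  have h5 : |c' - c| ≤ |b| ^ (r - 1) * (2 * t) ^ (2 - r) := by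
    calc |c' - c| = |c' - c| ^ (r - 1) * |c' - c| ^ (2 - r) := by
          rw [← Real.rpow_add_of_nonneg (abs_nonneg _) (by linarith) (by linarith)]
          norm_num
      _ ≤ _ := by
          refine mul_le_mul (Real.rpow_le_rpow (abs_nonneg _) h3 (by linarith))
            (Real.rpow_le_rpow (abs_nonneg _) h4 (by linarith)) (by positivity) (by positivity)
  have h6 : b * (c' - c) ≤ (2 * t) ^ (2 - r) * |b| ^ r := by
    calc b * (c' - c) ≤ |b| * |c' - c| := by rw [← abs_mul]; exact le_abs_self _
      _ ≤ |b| * (|b| ^ (r - 1) * (2 * t) ^ (2 - r)) := by gcongr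
      _ = (2 * t) ^ (2 - r) * (|b| ^ (1 : ℝ) * |b| ^ (r - 1)) := by rw [Real.rpow_one]; ring
      _ = _ := by
          rw [← Real.rpow_add_of_nonneg (abs_nonneg _) (by linarith) (by linarith)]
          norm_num
  linarith

end Huber

/-! ### A weak law under bounded moments of order `r`. -/

section WeakLaw

variable {Ω : Type*} [MeasurableSpace Ω] {μ : Measure Ω}

theorem integrable_clamp_comp_mul {t : ℝ} (ht : 0 ≤ t) {X Y : Ω → ℝ} (hX : Measurable X)
    (hY : Integrable Y μ) : Integrable (fun ω => clamp t (X ω) * Y ω) μ := by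
  refine hY.bdd_mul (c := t) ((continuous_clamp t).measurable.comp hX).aestronglyMeasurable ?_
  exact ae_of_all _ fun ω => by simpa using abs_clamp_le ht (X ω)

variable [IsProbabilityMeasure μ]

theorem integrable_huber {t : ℝ} (ht : 0 ≤ t) {X : Ω → ℝ} (hX : Measurable X)
    (hXi : Integrable X μ) : Integrable (fun ω => huber t (X ω)) μ := by
  have h1 := (integrable_clamp_comp_mul ht hX hXi).const_mul 2
  have h2 := integrable_clamp_comp_mul ht hX (Y := fun ω => clamp t (X ω)) (μ := μ) (by
    simpa using integrable_clamp_comp_mul ht hX (integrable_const (1 : ℝ)))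
  refine (h1.sub h2).congr (ae_of_all _ fun ω => ?_)
  simp only [Pi.sub_apply, huber]; ring

/-- Induction on the number of summands with `huber_add_le`: the first-order term has mean zero, the
new summand being centered and independent of the partial sum. Second moments, which may be
infinite, are never used. -/
theorem integral_huber_sum_le {X : ℕ → Ω → ℝ} (hm : ∀ i, Measurable (X i))
    (hind : iIndepFun X μ) (hint : ∀ i, Integrable (X i) μ) (hmean : ∀ i, ∫ ω, X i ω ∂μ = 0)
    {t r K : ℝ} (ht : 0 ≤ t) (hr1 : 1 ≤ r) (hr2 : r ≤ 2)
    (hri : ∀ i, Integrable (fun ω => |X i ω| ^ r) μ) (hK : ∀ i, ∫ ω, |X i ω| ^ r ∂μ ≤ K) (m : ℕ) :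
    ∫ ω, huber t (∑ i ∈ Finset.range m, X i ω) ∂μ ≤ m * (2 * (2 * t) ^ (2 - r) * K) := by
  induction m with
  | zero =>
    have : huber t 0 = 0 := by simp [huber, clamp, ht]
    simp [this]
  | succ m ih =>
    have hS : Measurable fun ω => ∑ i ∈ Finset.range m, X i ω :=
      Finset.measurable_fun_sum _ fun i _ => hm i
    have hSi : Integrable (fun ω => ∑ i ∈ Finset.range m, X i ω) μ :=
      integrable_finsetSum _ fun i _ => hint i
    have hci := integrable_clamp_comp_mul ht hS (hint m)
    have hSind : IndepFun (fun ω => ∑ i ∈ Finset.range m, X i ω) (X m) μ := by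
      have := hind.indepFun_sum_range_succ hm m
      convert this using 1
      ext ω; simp
    have hzero : ∫ ω, clamp t (∑ i ∈ Finset.range m, X i ω) * X m ω ∂μ = 0 := by
      have h1 := (hSind.comp (continuous_clamp t).measurable measurable_id)
      have h2 := h1.integral_fun_mul_eq_mul_integral
        ((continuous_clamp t).measurable.comp hS).aestronglyMeasurable
        (hm m).aestronglyMeasurable
      simpa [hmean m] using h2
    have hhub := integrable_huber ht hS hSi
    have hadd : Integrable (fun ω => huber t (∑ i ∈ Finset.range m, X i ω) +
        2 * (clamp t (∑ i ∈ Finset.range m, X i ω) * X m ω)) μ := hhub.add (hci.const_mul 2)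
    calc ∫ ω, huber t (∑ i ∈ Finset.range (m + 1), X i ω) ∂μ
        ≤ ∫ ω, (huber t (∑ i ∈ Finset.range m, X i ω) +
            2 * (clamp t (∑ i ∈ Finset.range m, X i ω) * X m ω) +
            2 * (2 * t) ^ (2 - r) * |X m ω| ^ r) ∂μ := by
          refine integral_mono ?_ (hadd.add ((hri m).const_mul _)) ?_
          · exact integrable_huber ht (Finset.measurable_fun_sum _ fun i _ => hm i)
              (integrable_finsetSum _ fun i _ => hint i)
          · intro ω
            simp only [Finset.sum_range_succ]
            exact huber_add_le ht hr1 hr2 _ _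
      _ = ∫ ω, huber t (∑ i ∈ Finset.range m, X i ω) ∂μ +
            2 * (2 * t) ^ (2 - r) * ∫ ω, |X m ω| ^ r ∂μ := by
          rw [integral_add hadd ((hri m).const_mul _),
            integral_add hhub (hci.const_mul 2), integral_const_mul, integral_const_mul, hzero]
          ring
      _ ≤ m * (2 * (2 * t) ^ (2 - r) * K) + 2 * (2 * t) ^ (2 - r) * K := by
          gcongr
          exact hK m
      _ = _ := by push_cast; ring

/-- A weak-type form of the von Bahr-Esseen inequality. -/
theorem measureReal_le_abs_sum_le {X : ℕ → Ω → ℝ} (hm : ∀ i, Measurable (X i))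
    (hind : iIndepFun X μ) (hint : ∀ i, Integrable (X i) μ) (hmean : ∀ i, ∫ ω, X i ω ∂μ = 0)
    {t r K : ℝ} (ht : 0 < t) (hr1 : 1 ≤ r) (hr2 : r ≤ 2)
    (hri : ∀ i, Integrable (fun ω => |X i ω| ^ r) μ) (hK : ∀ i, ∫ ω, |X i ω| ^ r ∂μ ≤ K) (m : ℕ) :
    μ.real {ω | t ≤ |∑ i ∈ Finset.range m, X i ω|} ≤ 2 * 2 ^ (2 - r) * K * (m * t ^ (-r)) := by
  have hS : Measurable fun ω => ∑ i ∈ Finset.range m, X i ω :=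
    Finset.measurable_fun_sum _ fun i _ => hm i
  have hSi : Integrable (fun ω => ∑ i ∈ Finset.range m, X i ω) μ :=
    integrable_finsetSum _ fun i _ => hint i
  have h1 := mul_meas_ge_le_integral_of_nonneg (μ := μ)
    (ae_of_all _ fun ω => huber_nonneg ht.le (∑ i ∈ Finset.range m, X i ω))
    (integrable_huber ht.le hS hSi) (t ^ 2)
  have h2 : μ.real {ω | t ≤ |∑ i ∈ Finset.range m, X i ω|} ≤
      μ.real {ω | t ^ 2 ≤ huber t (∑ i ∈ Finset.range m, X i ω)} :=
    measureReal_mono fun ω hω => sq_le_huber ht.le hω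
  have h3 := integral_huber_sum_le hm hind hint hmean ht.le hr1 hr2 hri hK m
  have h4 : (2 * t) ^ (2 - r) = 2 ^ (2 - r) * (t ^ 2 * t ^ (-r)) := by
    rw [Real.mul_rpow (by norm_num) ht.le, sub_eq_add_neg 2 r, Real.rpow_add ht]
    norm_num
  rw [h4] at h3
  refine le_of_mul_le_mul_left ?_ (pow_pos ht 2)
  calc t ^ 2 * μ.real {ω | t ≤ |∑ i ∈ Finset.range m, X i ω|}
      ≤ m * (2 * (2 ^ (2 - r) * (t ^ 2 * t ^ (-r))) * K) := by
        exact (mul_le_mul_of_nonneg_left h2 (by positivity)).trans (h1.trans h3)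
    _ = _ := by ring

/-- Weak law of large numbers with the normalisation `lam m`, `m ^ (-1 / r) * lam m → ∞`. -/
theorem tendsto_measure_le_abs_sum {X : ℕ → Ω → ℝ} (hm : ∀ i, Measurable (X i))
    (hind : iIndepFun X μ) (hint : ∀ i, Integrable (X i) μ) (hmean : ∀ i, ∫ ω, X i ω ∂μ = 0)
    {r K : ℝ} (hr1 : 1 ≤ r) (hr2 : r ≤ 2)
    (hri : ∀ i, Integrable (fun ω => |X i ω| ^ r) μ) (hK : ∀ i, ∫ ω, |X i ω| ^ r ∂μ ≤ K)
    {lam : ℕ → ℝ} (hlam : Tendsto (fun m : ℕ => (m : ℝ) ^ (-(1 / r)) * lam m) atTop atTop)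
    {η : ℝ} (hη : 0 < η) :
    Tendsto (fun m => μ {ω | η * lam m ≤ |∑ i ∈ Finset.range m, X i ω|}) atTop (𝓝 0) := by
  rw [← ENNReal.tendsto_toReal_zero_iff (fun _ => measure_ne_top _ _)]
  -- This is the tail bound at `t = η * lam m`, with the factor `m` absorbed as `(m ^ (-(1 / r))) ^
  -- (-r)`.
  have hlim : Tendsto (fun m : ℕ => 2 * 2 ^ (2 - r) * K * η ^ (-r) *
      ((m : ℝ) ^ (-(1 / r)) * lam m) ^ (-r)) atTop (𝓝 0) := by
    have := ((tendsto_rpow_neg_atTop (by linarith : 0 < r)).comp hlam).const_mul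
      (2 * 2 ^ (2 - r) * K * η ^ (-r))
    simpa using this
  refine squeeze_zero' (Eventually.of_forall fun _ => ENNReal.toReal_nonneg) ?_ hlim
  filter_upwards [hlam.eventually_gt_atTop 0, eventually_gt_atTop 0] with m hm1 hm0
  have hm0' : (0 : ℝ) < m := by exact_mod_cast hm0
  have hl : 0 < lam m := pos_of_mul_pos_right hm1 (by positivity)
  refine (measureReal_le_abs_sum_le hm hind hint hmean (mul_pos hη hl) hr1 hr2 hri hK m).trans_eq ?_
  have h1 : ((m : ℝ) ^ (-(1 / r))) ^ (-r) = m := by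
    rw [← Real.rpow_mul hm0'.le]
    have : -(1 / r) * -r = 1 := by field_simp
    rw [this, Real.rpow_one]
  rw [Real.mul_rpow hη.le hl.le, Real.mul_rpow (by positivity) hl.le, h1]
  ring

end WeakLaw

/-! ### Moment comparisons. -/

section Moments

variable {Ω : Type*} [MeasurableSpace Ω] {μ : Measure Ω}

theorem lintegral_ofReal_abs_rpow {X : Ω → ℝ} {p : ℝ} (hp : 0 ≤ p) :
    ∫⁻ ω, ENNReal.ofReal (|X ω| ^ p) ∂μ = ∫⁻ ω, ‖X ω‖ₑ ^ p ∂μ := by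
  simp_rw [← ENNReal.ofReal_rpow_of_nonneg (abs_nonneg _) hp, Real.enorm_eq_ofReal_abs]

theorem integrable_abs_rpow {X : Ω → ℝ} (hX : Measurable X) {p : ℝ} (hp : 0 ≤ p)
    (h : ∫⁻ ω, ‖X ω‖ₑ ^ p ∂μ < ∞) : Integrable (fun ω => |X ω| ^ p) μ := by
  refine (lintegral_ofReal_ne_top_iff_integrable (by fun_prop)
    (ae_of_all _ fun ω => by positivity)).1 ?_
  rw [lintegral_ofReal_abs_rpow hp]
  exact h.ne

theorem integral_abs_rpow {X : Ω → ℝ} (hX : Measurable X) {p : ℝ} (hp : 0 ≤ p) :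
    ∫ ω, |X ω| ^ p ∂μ = (∫⁻ ω, ‖X ω‖ₑ ^ p ∂μ).toReal := by
  rw [integral_eq_lintegral_of_nonneg_ae (ae_of_all _ fun ω => by positivity) (by fun_prop),
    lintegral_ofReal_abs_rpow hp]

theorem memLp_two_of_integrable_abs_rpow [IsFiniteMeasure μ] {X : Ω → ℝ} (hX : Measurable X)
    {r : ℝ} (hr : 1 ≤ r) (h : Integrable (fun ω => |X ω| ^ (2 * r)) μ) : MemLp X 2 μ := by
  rw [memLp_two_iff_integrable_sq hX.aestronglyMeasurable]
  refine ((integrable_const (1 : ℝ)).add h).mono' (by fun_prop) (ae_of_all _ fun ω => ?_)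
  rw [Real.norm_of_nonneg (sq_nonneg _), Pi.add_apply, ← sq_abs]
  have hnn := abs_nonneg (X ω)
  rcases le_total |X ω| 1 with h1 | h1
  · have : |X ω| ^ 2 ≤ 1 := pow_le_one₀ hnn h1
    have h2 : 0 ≤ |X ω| ^ (2 * r) := by positivity
    linarith
  · have : |X ω| ^ (2 : ℝ) ≤ |X ω| ^ (2 * r) := Real.rpow_le_rpow_of_exponent_le h1 (by linarith)
    rw [Real.rpow_two] at this
    linarith

theorem max_rpow_le_add {a b r : ℝ} (ha : 0 ≤ a) (hb : 0 ≤ b) : max a b ^ r ≤ a ^ r + b ^ r := by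
  have h1 : 0 ≤ a ^ r := by positivity
  have h2 : 0 ≤ b ^ r := by positivity
  rcases max_choice a b with h | h <;> rw [h] <;> linarith

/-- Transfers moments of order `2 r` of the errors to moments of order `r` of their centered
products. -/
theorem abs_mul_sub_rpow_le (x y c : ℝ) {r : ℝ} (hr : 0 ≤ r) :
    |x * y - c| ^ r ≤ 2 ^ r * (|x| ^ (2 * r) + |y| ^ (2 * r) + |c| ^ r) := by
  set M := max |x| |y|
  have hM : 0 ≤ M := le_max_of_le_left (abs_nonneg x)
  have h1 : |x * y - c| ≤ 2 * max (M ^ 2) |c| := by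
    have h2 : |x * y| ≤ M ^ 2 := by
      rw [abs_mul, sq]
      exact mul_le_mul (le_max_left _ _) (le_max_right _ _) (abs_nonneg _) hM
    calc |x * y - c| ≤ |x * y| + |c| := abs_sub _ _
      _ ≤ max (M ^ 2) |c| + max (M ^ 2) |c| :=
          add_le_add (h2.trans (le_max_left _ _)) (le_max_right _ _)
      _ = _ := by ring
  have h3 : (M ^ 2) ^ r = M ^ (2 * r) := by
    rw [Real.rpow_mul hM, Real.rpow_two]
  calc |x * y - c| ^ r ≤ (2 * max (M ^ 2) |c|) ^ r := by gcongr
    _ = 2 ^ r * max (M ^ 2) |c| ^ r := Real.mul_rpow (by norm_num) (by positivity)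
    _ ≤ 2 ^ r * (M ^ (2 * r) + |c| ^ r) := by
        rw [← h3]; gcongr; exact max_rpow_le_add (by positivity) (abs_nonneg _)
    _ ≤ _ := by gcongr; exact max_rpow_le_add (abs_nonneg _) (abs_nonneg _)

end Moments

/-! ### Probability estimates for the error matrix. -/

section ErrorModel

variable {Ω : Type*} [MeasurableSpace Ω] {μ : Measure Ω} {κ : Type*} [Fintype κ]
  {S : Matrix κ κ ℝ} {δ : ℕ → κ → Ω → ℝ}

/-- The matrix of the first `m` error vectors. -/
def errorMatrix (δ : ℕ → κ → Ω → ℝ) (m : ℕ) (ω : Ω) : Matrix (Fin m) κ ℝ :=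
  Matrix.of fun i j => δ i j ω

theorem integral_linear_comb_sq (hL2 : ∀ i j, MemLp (δ i j) 2 μ)
    (hcov : ∀ i j k, ∫ ω, δ i j ω * δ i k ω ∂μ = S j k) (i : ℕ) (x : κ → ℝ) :
    Integrable (fun ω => (∑ j, x j * δ i j ω) ^ 2) μ ∧
      ∫ ω, (∑ j, x j * δ i j ω) ^ 2 ∂μ = x ⬝ᵥ (S *ᵥ x) := by
  have hint : ∀ j k, Integrable (fun ω => x j * x k * (δ i j ω * δ i k ω)) μ := fun j k =>
    ((hL2 i j).integrable_mul (hL2 i k)).const_mul _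
  have hexp : ∀ ω, (∑ j, x j * δ i j ω) ^ 2 = ∑ j, ∑ k, x j * x k * (δ i j ω * δ i k ω) := by
    intro ω
    rw [sq, Finset.sum_mul_sum]
    exact Finset.sum_congr rfl fun j _ => Finset.sum_congr rfl fun k _ => by ring
  simp_rw [hexp]
  refine ⟨integrable_finsetSum _ fun j _ => integrable_finsetSum _ fun k _ => hint j k, ?_⟩
  rw [integral_finsetSum _ fun j _ => integrable_finsetSum _ fun k _ => hint j k]
  simp only [dotProduct, mulVec, Finset.mul_sum]
  refine Finset.sum_congr rfl fun j _ => ?_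
  rw [integral_finsetSum _ fun k _ => hint j k]
  refine Finset.sum_congr rfl fun k _ => ?_
  rw [integral_const_mul, hcov]; ring

theorem posSemidef_of_integral_mul (hL2 : ∀ i j, MemLp (δ i j) 2 μ)
    (hcov : ∀ i j k, ∫ ω, δ i j ω * δ i k ω ∂μ = S j k) : S.PosSemidef := by
  refine PosSemidef.of_dotProduct_mulVec_nonneg ?_ fun x => ?_
  · ext j k
    rw [conjTranspose_apply, ← hcov 0, ← hcov 0]
    simp [mul_comm]
  · rw [star_trivial, ← (integral_linear_comb_sq hL2 hcov 0 x).2]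
    exact integral_nonneg fun ω => sq_nonneg _

/-- The columns of `1 - P_Σ` lie in the kernel of `Σ`, so the corresponding combinations of errors
have second moment zero and vanish almost surely. -/
theorem ae_errorMatrix_mul_colProj [DecidableEq κ] (hL2 : ∀ i j, MemLp (δ i j) 2 μ)
    (hcov : ∀ i j k, ∫ ω, δ i j ω * δ i k ω ∂μ = S j k) (m : ℕ) :
    ∀ᵐ ω ∂μ, errorMatrix δ m ω * colProj S = errorMatrix δ m ω := by
  have hS : Sᵀ = S := by
    simpa [IsHermitian] using (posSemidef_of_integral_mul hL2 hcov).isHermitian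
  have hS0 : S * (1 - colProj S) = 0 := by
    have := congrArg transpose (colProj_mul_self S)
    rw [transpose_mul, hS, colProj_transpose] at this
    rw [Matrix.mul_sub, this, Matrix.mul_one, sub_self]
  have h : ∀ (i : ℕ) (k : κ), ∀ᵐ ω ∂μ, ∑ j, (1 - colProj S) j k * δ i j ω = 0 := by
    intro i k
    obtain ⟨h1, h2⟩ := integral_linear_comb_sq hL2 hcov i (fun j => (1 - colProj S) j k)
    have h3 : S *ᵥ (fun j => (1 - colProj S) j k) = 0 := by
      ext l
      exact congrFun (congrFun hS0 l) k
    rw [h3, dotProduct_zero, integral_eq_zero_iff_of_nonneg (fun ω => sq_nonneg _) h1] at h2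
    filter_upwards [h2] with ω hω
    simpa using hω
  filter_upwards [ae_all_iff.2 fun i => ae_all_iff.2 (h i)] with ω hω
  have h0 : errorMatrix δ m ω * (1 - colProj S) = 0 := by
    ext i k
    rw [mul_apply, Matrix.zero_apply, ← hω i k]
    exact Finset.sum_congr rfl fun j _ => mul_comm _ _
  rw [Matrix.mul_sub, Matrix.mul_one, sub_eq_zero] at h0
  exact h0.symm

/-- Expand the square: products from distinct rows have mean zero by independence, and the diagonal
ones contribute `H i l ^ 2 * S k k`. -/
theorem integral_norm_mul_errorMatrix_sq (hmeas : ∀ i j, Measurable (δ i j))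
    (hindep : iIndepFun (fun i ω j => δ i j ω) μ) (hmean : ∀ i j, ∫ ω, δ i j ω ∂μ = 0)
    (hL2 : ∀ i j, MemLp (δ i j) 2 μ)
    (hcov : ∀ i j k, ∫ ω, δ i j ω * δ i k ω ∂μ = S j k) {m : ℕ} {ι : Type*} [Fintype ι]
    (H : Matrix ι (Fin m) ℝ) :
    Integrable (fun ω => ‖H * errorMatrix δ m ω‖ ^ 2) μ ∧
      ∫ ω, ‖H * errorMatrix δ m ω‖ ^ 2 ∂μ = ‖H‖ ^ 2 * S.trace := by
  have hcross : ∀ (k : κ) (l l' : Fin m),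
      ∫ ω, δ l k ω * δ l' k ω ∂μ = if l = l' then S k k else 0 := by
    intro k l l'
    split_ifs with h
    · rw [h, hcov]
    · have h1 : IndepFun (δ l k) (δ l' k) μ :=
        (hindep.indepFun (i := (l : ℕ)) (j := (l' : ℕ)) (by simpa [Fin.ext_iff] using h)).comp
          (measurable_pi_apply k) (measurable_pi_apply k)
      rw [h1.integral_fun_mul_eq_mul_integral (hmeas _ _).aestronglyMeasurable
        (hmeas _ _).aestronglyMeasurable, hmean]
      simp
  have hexp : ∀ ω, ‖H * errorMatrix δ m ω‖ ^ 2 =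
      ∑ i, ∑ k, ∑ l, ∑ l', H i l * H i l' * (δ l k ω * δ l' k ω) := by
    intro ω
    rw [norm_sq_eq_sum]
    refine Finset.sum_congr rfl fun i _ => Finset.sum_congr rfl fun k _ => ?_
    rw [mul_apply, sq, Finset.sum_mul_sum]
    refine Finset.sum_congr rfl fun l _ => Finset.sum_congr rfl fun l' _ => ?_
    simp only [errorMatrix, of_apply]; ring
  have hint : ∀ (i : ι) (k : κ) (l l' : Fin m),
      Integrable (fun ω => H i l * H i l' * (δ l k ω * δ l' k ω)) μ := fun i k l l' =>
    ((hL2 l k).integrable_mul (hL2 l' k)).const_mul _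
  have hint3 := fun i k l => integrable_finsetSum Finset.univ fun l' _ => hint i k l l'
  have hint2 := fun i k => integrable_finsetSum Finset.univ fun l _ => hint3 i k l
  have hint1 := fun i => integrable_finsetSum Finset.univ fun k _ => hint2 i k
  simp_rw [hexp]
  refine ⟨integrable_finsetSum _ fun i _ => hint1 i, ?_⟩
  rw [integral_finsetSum _ fun i _ => hint1 i, norm_sq_eq_sum, Finset.sum_mul]
  refine Finset.sum_congr rfl fun i _ => ?_
  rw [integral_finsetSum _ fun k _ => hint2 i k, trace, Finset.mul_sum]
  refine Finset.sum_congr rfl fun k _ => ?_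
  rw [integral_finsetSum _ fun l _ => hint3 i k l, Finset.sum_mul]
  refine Finset.sum_congr rfl fun l _ => ?_
  rw [integral_finsetSum _ fun l' _ => hint i k l l']
  simp_rw [integral_const_mul, hcross]
  simp [sq]

theorem norm_colProj_sq_le {ι κ : Type*} [Fintype ι] [Fintype κ] (A : Matrix ι κ ℝ) :
    ‖colProj A‖ ^ 2 ≤ Fintype.card κ := by
  rw [norm_sq_eq_trace, colProj_transpose, colProj_mul_colProj]
  exact trace_colProj_le A

/-- The projection of the errors onto the column space of the regressors is negligible. -/
theorem tendsto_measure_norm_colProj_mul [IsProbabilityMeasure μ]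
    (hmeas : ∀ i j, Measurable (δ i j))
    (hindep : iIndepFun (fun i ω j => δ i j ω) μ) (hmean : ∀ i j, ∫ ω, δ i j ω ∂μ = 0)
    (hL2 : ∀ i j, MemLp (δ i j) 2 μ)
    (hcov : ∀ i j k, ∫ ω, δ i j ω * δ i k ω ∂μ = S j k) {n : ℕ}
    (A : (m : ℕ) → Matrix (Fin m) (Fin n) ℝ) {lam : ℕ → ℝ} (hlam : Tendsto lam atTop atTop)
    {η : ℝ} (hη : 0 < η) :
    Tendsto (fun m => μ {ω | η * lam m ≤ ‖colProj (A m) * errorMatrix δ m ω‖ ^ 2})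
      atTop (𝓝 0) := by
  rw [← ENNReal.tendsto_toReal_zero_iff (fun _ => measure_ne_top _ _)]
  have hlim : Tendsto (fun m => (n * S.trace / η) / lam m) atTop (𝓝 0) :=
    hlam.const_div_atTop _
  refine squeeze_zero' (Eventually.of_forall fun _ => ENNReal.toReal_nonneg) ?_ hlim
  filter_upwards [hlam.eventually_gt_atTop 0] with m hm
  obtain ⟨h1, h2⟩ := integral_norm_mul_errorMatrix_sq hmeas hindep hmean hL2 hcov (colProj (A m))
  have h3 := mul_meas_ge_le_integral_of_nonneg (ae_of_all _ fun ω => sq_nonneg _) h1 (η * lam m)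
  rw [h2] at h3
  have h4 : ‖colProj (A m)‖ ^ 2 * S.trace ≤ n * S.trace := by
    refine mul_le_mul_of_nonneg_right ?_ (posSemidef_of_integral_mul hL2 hcov).trace_nonneg
    simpa using norm_colProj_sq_le (A m)
  rw [div_div, le_div_iff₀ (by positivity), mul_comm]
  exact h3.trans h4

/-- The sample covariance of the errors is close to `S`, on the scale `lam m`. -/
theorem tendsto_measure_norm_gram_sub [IsProbabilityMeasure μ]
    (hmeas : ∀ i j, Measurable (δ i j))
    (hindep : iIndepFun (fun i ω j => δ i j ω) μ)
    (hL2 : ∀ i j, MemLp (δ i j) 2 μ)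
    (hcov : ∀ i j k, ∫ ω, δ i j ω * δ i k ω ∂μ = S j k)
    {r M : ℝ} (hr1 : 1 ≤ r) (hr2 : r ≤ 2)
    (hint : ∀ i j, Integrable (fun ω => |δ i j ω| ^ (2 * r)) μ)
    (hM : ∀ i j, ∫ ω, |δ i j ω| ^ (2 * r) ∂μ ≤ M)
    {lam : ℕ → ℝ} (hlam : Tendsto (fun m : ℕ => (m : ℝ) ^ (-(1 / r)) * lam m) atTop atTop)
    {η : ℝ} (hη : 0 < η) :
    Tendsto (fun m => μ {ω | η * lam m <
      ‖(errorMatrix δ m ω)ᵀ * errorMatrix δ m ω - (m : ℝ) • S‖}) atTop (𝓝 0) := by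
  classical
  -- If every entry is at most `η * lam m / N`, the Frobenius norm is at most `card κ` times that,
  -- so a union bound over entries suffices. The extra one avoids dividing by zero when `κ` is
  -- empty.
  set N : ℝ := Fintype.card κ + 1
  have hN : 0 < N := by positivity
  have hentry : ∀ j k, Tendsto (fun m => μ {ω | η / N * lam m ≤
      |∑ i ∈ Finset.range m, (δ i j ω * δ i k ω - S j k)|}) atTop (𝓝 0) := by
    intro j k
    have hi : ∀ i, Integrable (fun ω => δ i j ω * δ i k ω) μ := fun i =>
      (hL2 i j).integrable_mul (hL2 i k)
    have hbd : ∀ i, Integrable (fun ω =>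
        2 ^ r * (|δ i j ω| ^ (2 * r) + |δ i k ω| ^ (2 * r) + |S j k| ^ r)) μ := fun i =>
      (((hint i j).add (hint i k)).add (integrable_const _)).const_mul _
    have hXr : ∀ i, Integrable (fun ω => |δ i j ω * δ i k ω - S j k| ^ r) μ := by
      intro i
      refine (hbd i).mono' ?_ (ae_of_all _ fun ω => ?_)
      · have := hmeas i j
        have := hmeas i k
        have hr0 : 0 ≤ r := by linarith
        fun_prop (disch := assumption)
      · rw [Real.norm_of_nonneg (by positivity)]
        exact abs_mul_sub_rpow_le _ _ _ (by linarith)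
    refine tendsto_measure_le_abs_sum (X := fun i ω => δ i j ω * δ i k ω - S j k)
      (r := r) (K := 2 ^ r * (M + M + |S j k| ^ r)) ?_ ?_ ?_ ?_ hr1 hr2 hXr ?_ hlam (by positivity)
    · exact fun i => ((hmeas i j).mul (hmeas i k)).sub_const _
    · exact hindep.comp (fun _ v => v j * v k - S j k) (fun _ => by fun_prop)
    · exact fun i => (hi i).sub (integrable_const _)
    · intro i
      rw [integral_sub (hi i) (integrable_const _), hcov]; simp
    · intro i
      calc ∫ ω, |δ i j ω * δ i k ω - S j k| ^ r ∂μ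
          ≤ ∫ ω, 2 ^ r * (|δ i j ω| ^ (2 * r) + |δ i k ω| ^ (2 * r) + |S j k| ^ r) ∂μ :=
            integral_mono (hXr i) (hbd i) fun ω => abs_mul_sub_rpow_le _ _ _ (by linarith)
        _ = 2 ^ r * (∫ ω, |δ i j ω| ^ (2 * r) ∂μ + ∫ ω, |δ i k ω| ^ (2 * r) ∂μ + |S j k| ^ r) := by
            have hadd : Integrable (fun ω => |δ i j ω| ^ (2 * r) + |δ i k ω| ^ (2 * r)) μ :=
              (hint i j).add (hint i k)
            rw [integral_const_mul, integral_add hadd (integrable_const _),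
              integral_add (hint i j) (hint i k)]
            simp
        _ ≤ _ := by gcongr <;> exact hM _ _
  have hsum : Tendsto (fun m => ∑ j, ∑ k, μ {ω | η / N * lam m ≤
      |∑ i ∈ Finset.range m, (δ i j ω * δ i k ω - S j k)|}) atTop (𝓝 0) := by
    simpa using tendsto_finsetSum Finset.univ fun j _ =>
      tendsto_finsetSum Finset.univ fun k _ => hentry j k
  have hpos : ∀ᶠ m in atTop, 0 < lam m := by
    filter_upwards [hlam.eventually_gt_atTop 0] with m hm
    exact pos_of_mul_pos_right hm (by positivity)
  refine tendsto_of_tendsto_of_tendsto_of_le_of_le' tendsto_const_nhds hsum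
    (Eventually.of_forall fun _ => zero_le) ?_
  filter_upwards [hpos] with m hm
  refine le_trans (measure_mono (t := ⋃ j, ⋃ k, {ω | η / N * lam m ≤
      |∑ i ∈ Finset.range m, (δ i j ω * δ i k ω - S j k)|}) ?_) ?_
  · intro ω hω
    by_contra hcon
    simp only [Set.mem_iUnion, not_exists] at hcon
    refine absurd (show η * lam m < _ from hω) (not_lt.2 ?_)
    have hent : ∀ j k, ((errorMatrix δ m ω)ᵀ * errorMatrix δ m ω - (m : ℝ) • S) j k =
        ∑ i ∈ Finset.range m, (δ i j ω * δ i k ω - S j k) := by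
      intro j k
      rw [Finset.sum_range]
      simp [mul_apply, errorMatrix]
    have hc : (0 : ℝ) ≤ Fintype.card κ := by positivity
    refine le_of_sq_le_sq ?_ (by positivity)
    rw [norm_sq_eq_sum]
    calc _ ≤ ∑ _j : κ, ∑ _k : κ, (η / N * lam m) ^ 2 := by
          refine Finset.sum_le_sum fun j _ => Finset.sum_le_sum fun k _ => ?_
          rw [hent, ← sq_abs]
          exact pow_le_pow_left₀ (abs_nonneg _) (not_le.1 (hcon j k)).le 2
      _ = (Fintype.card κ * (η / N * lam m)) ^ 2 := by simp; ring
      _ ≤ (N * (η / N * lam m)) ^ 2 := by gcongr; simp [N]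
      _ = (η * lam m) ^ 2 := by congr 1; field_simp
  · refine (measure_iUnion_fintype_le _ _).trans (Finset.sum_le_sum fun j _ => ?_)
    exact measure_iUnion_fintype_le _ _

end ErrorModel

end TLS

/-! ### Assembly of the consistency theorem. -/

theorem mainTheorem1
    {Ω : Type*} [MeasurableSpace Ω] (μ : Measure Ω) [IsProbabilityMeasure μ]
    (n d : ℕ) (hn : 1 ≤ n) (hd : 1 ≤ d)
    -- true regressors, true coefficient matrix, error covariance matrix, errors
    (a₀ : ℕ → Fin n → ℝ) (X₀ : Matrix (Fin n) (Fin d) ℝ)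
    (S : Matrix (Fin n ⊕ Fin d) (Fin n ⊕ Fin d) ℝ)
    (δ : ℕ → Fin n ⊕ Fin d → Ω → ℝ)
    (hmeas : ∀ i j, Measurable (δ i j))
    -- the error vectors are independent, centered, with common covariance matrix `S`
    (hindep : iIndepFun (fun i ω j => δ i j ω) μ)
    (hmean : ∀ i j, ∫ ω, δ i j ω ∂μ = 0)
    (hcov : ∀ i j k, ∫ ω, δ i j ω * δ i k ω ∂μ = S j k)
    (hrank : (S * TLS.augment X₀).rank = d)
    -- moment condition and growth condition
    (r : ℝ) (hr1 : 1 ≤ r) (hr2 : r ≤ 2)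
    (hmoment : (⨆ (i : ℕ) (j : Fin n ⊕ Fin d), ∫⁻ ω, ‖δ i j ω‖ₑ ^ (2 * r) ∂μ) < ∞)
    (hgrowth : Tendsto (fun m : ℕ => (m : ℝ) ^ (-(1 / r)) *
      TLS.lambdaMin ((TLS.trueRegressors a₀ m)ᵀ * TLS.trueRegressors a₀ m)) atTop atTop) :
    -- the estimation problem always has a solution
    (∀ m ω, ∃ Δ Z, TLS.IsSolution S (TLS.observations a₀ X₀ (fun i j => δ i j ω) m) Δ Z) ∧
    -- whichever solutions are chosen, the estimation succeeds with probability tending to one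
    -- and the estimator converges to `X₀` in probability
    ∀ (Δhat : (m : ℕ) → Ω → Matrix (Fin m) (Fin n ⊕ Fin d) ℝ)
      (Zhat : ℕ → Ω → Matrix (Fin n ⊕ Fin d) (Fin d) ℝ)
      (Xhat : ℕ → Ω → Matrix (Fin n) (Fin d) ℝ),
      (∀ m, ∀ᵐ ω ∂μ, TLS.IsSolution S (TLS.observations a₀ X₀ (fun i j => δ i j ω) m)
        (Δhat m ω) (Zhat m ω)) →
      (∀ m, ∀ᵐ ω ∂μ, TLS.Succeeds (Zhat m ω) → TLS.IsEstimate (Zhat m ω) (Xhat m ω)) →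
      Tendsto (fun m => μ {ω | ¬ TLS.Succeeds (Zhat m ω)}) atTop (𝓝 0) ∧
      TendstoInMeasure μ Xhat atTop (fun _ => X₀) := by
  have hle : ∀ i j, ∫⁻ ω, ‖δ i j ω‖ₑ ^ (2 * r) ∂μ ≤
      ⨆ (i : ℕ) (j : Fin n ⊕ Fin d), ∫⁻ ω, ‖δ i j ω‖ₑ ^ (2 * r) ∂μ := fun i j =>
    le_iSup₂ (f := fun (i : ℕ) (j : Fin n ⊕ Fin d) => ∫⁻ ω, ‖δ i j ω‖ₑ ^ (2 * r) ∂μ) i j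
  have hint : ∀ i j, Integrable (fun ω => |δ i j ω| ^ (2 * r)) μ := fun i j =>
    TLS.integrable_abs_rpow (hmeas i j) (by linarith) ((hle i j).trans_lt hmoment)
  have hM : ∀ i j, ∫ ω, |δ i j ω| ^ (2 * r) ∂μ ≤
      (⨆ (i : ℕ) (j : Fin n ⊕ Fin d), ∫⁻ ω, ‖δ i j ω‖ₑ ^ (2 * r) ∂μ).toReal := fun i j => by
    rw [TLS.integral_abs_rpow (hmeas i j) (by linarith)]
    exact ENNReal.toReal_mono hmoment.ne (hle i j)
  have hL2 : ∀ i j, MemLp (δ i j) 2 μ := fun i j =>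
    TLS.memLp_two_of_integrable_abs_rpow (hmeas i j) hr1 (hint i j)
  have hS := TLS.posSemidef_of_integral_mul hL2 hcov
  have hSr : d ≤ S.rank := hrank.ge.trans (rank_mul_le_left _ _)
  refine ⟨fun m ω => TLS.exists_isSolution hS hSr _, fun Δhat Zhat Xhat hsol hest => ?_⟩
  have : Nonempty (Fin n) := ⟨⟨0, hn⟩⟩
  set lam : ℕ → ℝ := fun m =>
    TLS.lambdaMin ((TLS.trueRegressors a₀ m)ᵀ * TLS.trueRegressors a₀ m)
  have hpos : ∀ᶠ m in atTop, 0 < lam m := by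
    filter_upwards [hgrowth.eventually_gt_atTop 0] with m hm
    exact pos_of_mul_pos_right hm (by positivity)
  -- The factor `m ^ (-(1 / r))` is at most one for `m ≥ 1`, so `lam` dominates the sequence in the
  -- growth condition.
  have hlam : Tendsto lam atTop atTop := by
    refine tendsto_atTop_mono' _ ?_ hgrowth
    filter_upwards [hpos, eventually_ge_atTop 1] with m hm hm1
    refine mul_le_of_le_one_left hm.le (Real.rpow_le_one_of_one_le_of_nonpos ?_ ?_)
    · exact_mod_cast hm1
    · have : 0 ≤ 1 / r := by positivity
      linarith
  have hobs : ∀ m ω, TLS.observations a₀ X₀ (fun i j => δ i j ω) m =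
      TLS.trueRegressors a₀ m * TLS.rowAugment X₀ + TLS.errorMatrix δ m ω := fun m ω => by
    rw [TLS.mul_rowAugment]; rfl
  have key : ∀ ε > 0, Tendsto (fun m => μ {ω | ¬ (TLS.Succeeds (Zhat m ω) ∧
      ‖Xhat m ω - X₀‖ < ε)}) atTop (𝓝 0) := by
    intro ε hε
    obtain ⟨η, hη, hdet⟩ := TLS.exists_forall_succeeds_and_norm_sub_le hS hrank hε
    have hlim := (TLS.tendsto_measure_norm_gram_sub hmeas hindep hL2 hcov hr1 hr2 hint hM
      hgrowth hη).add (TLS.tendsto_measure_norm_colProj_mul hmeas hindep hmean hL2 hcov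
      (TLS.trueRegressors a₀) hlam hη)
    rw [add_zero] at hlim
    refine tendsto_of_tendsto_of_tendsto_of_le_of_le' tendsto_const_nhds hlim
      (Eventually.of_forall fun _ => zero_le) ?_
    filter_upwards [hpos] with m hm
    -- Outside the two bad events the deterministic bound applies almost surely. Monotonicity and
    -- subadditivity hold for outer measure, so the chosen estimators need not be measurable.
    refine (measure_mono_ae ?_).trans (measure_union_le _ _)
    filter_upwards [hsol m, hest m, TLS.ae_errorMatrix_mul_colProj hL2 hcov m]
      with ω hsolω hestω hEω hbad
    by_contra hcon
    have hcon' := not_or.1 hcon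
    rw [hobs] at hsolω
    obtain ⟨h1, h2⟩ := hdet m _ _ _ _ hm hEω (not_lt.1 hcon'.1) (not_le.1 hcon'.2).le hsolω
    exact hbad ⟨h1, h2 _ (hestω h1)⟩
  constructor
  · refine tendsto_of_tendsto_of_tendsto_of_le_of_le tendsto_const_nhds (key 1 one_pos)
      (fun _ => zero_le) fun m => measure_mono ?_
    exact fun ω hω h => hω h.1
  · rw [tendstoInMeasure_iff_norm]
    intro ε hε
    refine tendsto_of_tendsto_of_tendsto_of_le_of_le tendsto_const_nhds (key ε hε)
      (fun _ => zero_le) fun m => measure_mono ?_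
    exact fun ω hω h => (not_lt.2 hω) h.2
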